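/- **Conventions.** Let $X$ be a proper CAT(0) space with basepoint $x_0$. Let $\partial X$ be its visual boundary, i.e. geodesic rays up to finite Hausdorff distance, with the topology whose basic neighborhoods consist of the rays from $x_0$ that stay $\epsilon$-close to a given ray from $x_0$ for distance $R$. For a geodesic $\alpha$ let $\pi_\alpha$ be the nearest point projection; $\alpha$ is *$D$-contracting* ($D\ge 0$) if $\pi_\alpha(B)$ has diameter at most $D$ for every metric ball $B$ disjoint from $\alpha$. Let $\partial_*^D X\subseteq\partial X$ be the subspace of points represented by $D$-contracting rays from $x_0$. The Morse boundary is $\partial_* X=\bigcup_{D}\partial_*^DX$ with the direct limit topology. For $a,c\in\partial_*X$ let $(a,c)$ be the set of bi-infinite geodesics from $a$ to $c$. Let $\partial_*X^{(n,D)}$ be the set of $n$-tuples of distinct points of $\partial_*X$ such that every bi-infinite geodesic between any two of them is $D$-contracting. For $\alpha\in(a,c)$ and $b\in\partial_*X\setminus\{a,c\}$, let $P_\alpha(b)\subset\alpha$ be the set of all limits of sequences $\pi_\alpha(\beta(t_i))$ with $t_i\to\infty$ and $\beta$ a ray representing $b$, and let $\pi_\alpha(b)$ be the barycenter of $P_\alpha(b)$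 (the midpoint of the smallest segment of $\alpha$ containing it). For distinct $a,b,c,d$ the absolute value of the cross-ratio is $$|[a,b,c,d]|=\sup_{\alpha\in(a,c)}d(\pi_\alpha(b),\pi_\alpha(d)).$$ A map $f:\partial_*X\to\partial_*Y$ is *2-stable* if for every $D\ge0$ there is $D'\ge0$ such that $f$ maps $\partial_*X^{(2,D)}$ into $\partial_*Y^{(2,D')}$. It is *$D$-quasi-mobius* if there is a continuous $\psi_D:[0,\infty)\to[0,\infty)$ with $|[f(a),f(b),f(c),f(d)]|\le\psi_D(|[a,b,c,d]|)$ for all $(a,b,c,d)\in\partial_*X^{(4,D)}$. A homeomorphism $f$ is *quasi-mobius* if $f$ and $f^{-1}$ are $D$-quasi-mobius for every $D\ge 0$. For a quasi-isometry $h:X\to Y$ (coarsely surjective), $\partial_*h:\partial_*X\to\partial_*Y$ denotes the induced map: for $p\in\partial_*X$ represented by a ray $\alpha$, $\partial_*h(p)$ is the class of the geodesic rays in $Y$ at finite Hausdorff distance from $h\circ\alpha$. **Theorem.** Let $X$ and $Y$ be proper CAT(0) spaces with proper (i.e. properly discontinuous), cocompact isometric actions of groups $G\curvearrowright X$ and $H\curvearrowright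 Y$, and assume that $\partial_*X$ has at least 3 points. Suppose that $f:\partial_*X\to\partial_*Y$ is a homeomorphism such that $f$ and $f^{-1}$ are both 2-stable and quasi-mobius. Then there exists a quasi-isometry $h:X\to Y$ with $\partial_*h=f$. -/

import Mathlib

open Set Filter Topology Metric
open scoped NNReal

namespace MorseBdry

noncomputable section

/-- A CAT(0) space: a geodesic metric space in which every geodesic triangle is at least as thin as
its Euclidean comparison triangle.  In a geodesic space, `dist p x + dist x q = dist p q` says that
`x` lies on some geodesic segment from `p` to `q`, so in `comparison` the points `x`, `y` range
over the points on two sides `[p, q]`, `[p, r]` of a geodesic triangle, `p' q' r'` is a comparison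
triangle in the Euclidean plane, and `x'`, `y'` are the comparison points. -/
class CAT0Space (X : Type*) [MetricSpace X] : Prop where
  geodesic : ∀ x y : X, ∃ γ : ℝ → X, γ 0 = x ∧ γ (dist x y) = y ∧
    ∀ s ∈ Icc 0 (dist x y), ∀ t ∈ Icc 0 (dist x y), dist (γ s) (γ t) = |s - t|
  comparison : ∀ p q r x y : X,
    dist p x + dist x q = dist p q → dist p y + dist y r = dist p r →
    ∀ p' q' r' x' y' : EuclideanSpace ℝ (Fin 2),
      dist p' q' = dist p q → dist q' r' = dist q r → dist p' r' = dist p r →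
      dist p' x' = dist p x → dist x' q' = dist x q →
      dist p' y' = dist p y → dist y' r' = dist y r →
      dist x y ≤ dist x' y'

/-- The action of `G` on `X` is cocompact: the translates of some compact set cover `X`. -/
def IsCocompactAction (G X : Type*) [TopologicalSpace X] [SMul G X] : Prop :=
  ∃ K : Set X, IsCompact K ∧ ∀ x : X, ∃ g : G, ∃ k ∈ K, g • k = x

section Projections

variable {X : Type*} [MetricSpace X]

/-- `p` is a nearest point to `x` in `A`, i.e. `p = π_A(x)`. -/
def IsNearestPoint (A : Set X) (x p : X) : Prop :=
  p ∈ A ∧ dist x p = infDist x A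

/-- The (image of a) geodesic `A` is `D`-contracting: for every metric ball disjoint from `A`, the
nearest point projection of the ball to `A` has diameter at most `D`. -/
def IsContracting (D : ℝ≥0) (A : Set X) : Prop :=
  ∀ (x : X) (r : ℝ), Disjoint (ball x r) A →
    ∀ y ∈ ball x r, ∀ z ∈ ball x r, ∀ p q : X,
      IsNearestPoint A y p → IsNearestPoint A z q → dist p q ≤ D

end Projections

section Boundary

variable (X : Type*) [MetricSpace X]

/-- A geodesic ray. -/
structure GeodesicRay where
  toFun : ℝ≥0 → X
  isometry : Isometry toFun

/-- A bi-infinite geodesic. -/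
structure GeodesicLine where
  toFun : ℝ → X
  isometry : Isometry toFun

instance : CoeFun (GeodesicRay X) (fun _ => ℝ≥0 → X) := ⟨GeodesicRay.toFun⟩

instance : CoeFun (GeodesicLine X) (fun _ => ℝ → X) := ⟨GeodesicLine.toFun⟩

/-- Two geodesic rays are equivalent if they have finite Hausdorff distance. -/
def asymptoticSetoid : Setoid (GeodesicRay X) where
  r β γ := hausdorffEDist (range β) (range γ) ≠ ⊤
  iseqv :=
    { refl := fun β => by simp
      symm := fun h => by rwa [hausdorffEDist_comm]
      trans := fun h₁ h₂ => ne_top_of_le_ne_top (ENNReal.add_ne_top.2 ⟨h₁, h₂⟩)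
        hausdorffEDist_triangle }

/-- The visual boundary `∂X`, as a set. -/
def VisualBoundary : Type _ := Quotient (asymptoticSetoid X)

variable {X}

/-- The boundary point that a ray represents. -/
def GeodesicRay.endpoint (β : GeodesicRay X) : VisualBoundary X :=
  Quotient.mk (asymptoticSetoid X) β

/-- The two halves of a bi-infinite geodesic. -/
def GeodesicLine.forward (α : GeodesicLine X) : GeodesicRay X where
  toFun t := α (t : ℝ)
  isometry := Isometry.of_dist_eq fun s t => by
    rw [α.isometry.dist_eq]; rfl

def GeodesicLine.backward (α : GeodesicLine X) : GeodesicRay X where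
  toFun t := α (-(t : ℝ))
  isometry := Isometry.of_dist_eq fun s t => by
    rw [α.isometry.dist_eq, dist_neg_neg]; rfl

/-- `α ∈ (a, c)`: the bi-infinite geodesic `α` goes from `a` to `c`. -/
def GeodesicLine.Joins (α : GeodesicLine X) (a c : VisualBoundary X) : Prop :=
  α.backward.endpoint = a ∧ α.forward.endpoint = c

/-- The basic neighborhood of (the class of) the ray `γ` in the visual boundary: the classes of the
rays with origin `x₀` that stay `ε`-close to `γ` for distance `R`. -/
def coneNhd (x₀ : X) (γ : GeodesicRay X) (R : ℝ≥0) (ε : ℝ) : Set (VisualBoundary X) :=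
  {ξ | ∃ β : GeodesicRay X, β 0 = x₀ ∧ β.endpoint = ξ ∧ ∀ t ≤ R, dist (γ t) (β t) < ε}

/-- The topology of the visual boundary, described by rays with origin `x₀`. -/
@[reducible] def visualTopology (x₀ : X) : TopologicalSpace (VisualBoundary X) :=
  TopologicalSpace.generateFrom
    {U | ∃ (γ : GeodesicRay X) (R : ℝ≥0) (ε : ℝ), γ 0 = x₀ ∧ 0 < ε ∧ U = coneNhd x₀ γ R ε}

/-- `∂_*^D X`: the boundary points represented by a `D`-contracting ray with origin `x₀`. -/
def stratum (x₀ : X) (D : ℝ≥0) : Set (VisualBoundary X) :=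
  {ξ | ∃ β : GeodesicRay X, β 0 = x₀ ∧ β.endpoint = ξ ∧ IsContracting D (range β)}

/-- The Morse boundary `∂_* X` (with basepoint `x₀`), the union of the strata `∂_*^D X`. -/
def MorseBoundary (X : Type*) [MetricSpace X] (x₀ : X) : Type _ :=
  {ξ : VisualBoundary X // ∃ D : ℝ≥0, ξ ∈ stratum x₀ D}

/-- The underlying point of the visual boundary. -/
def MorseBoundary.toVisual {x₀ : X} (a : MorseBoundary X x₀) : VisualBoundary X := a.1

/-- The inclusion `∂_*^D X → ∂_* X`. -/
def stratumInclusion (x₀ : X) (D : ℝ≥0) (ξ : stratum x₀ D) : MorseBoundary X x₀ :=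
  ⟨ξ.1, D, ξ.2⟩

/-- The direct limit topology on the Morse boundary, i.e. the finest one for which all inclusions
of the strata are continuous, each stratum having the subspace topology from `∂X`. -/
instance (x₀ : X) : TopologicalSpace (MorseBoundary X x₀) :=
  ⨆ D : ℝ≥0, TopologicalSpace.coinduced (stratumInclusion x₀ D)
    (TopologicalSpace.induced (Subtype.val : stratum x₀ D → VisualBoundary X) (visualTopology x₀))

/-- `∂_* X^(n, D)`: the `n`-tuples of distinct points of the Morse boundary such that every
bi-infinite geodesic between two of them is `D`-contracting. -/
def contractingTuples (x₀ : X) (n : ℕ) (D : ℝ≥0) : Set (Fin n → MorseBoundary X x₀) :=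
  {a | Function.Injective a ∧ ∀ i j, i ≠ j → ∀ α : GeodesicLine X,
    α.Joins (a i).toVisual (a j).toVisual → IsContracting D (range α)}

/-- The parameters of the points of the set `P_α(b)`: all limits of sequences `π_α(β(t_i))` with
`t_i → ∞`, for rays `β` representing `b`. -/
def boundaryProjParams (α : GeodesicLine X) (b : VisualBoundary X) : Set ℝ :=
  {s | ∃ β : GeodesicRay X, β.endpoint = b ∧ ∃ (t : ℕ → ℝ≥0) (u : ℕ → ℝ),
    Tendsto t atTop atTop ∧ (∀ i, IsNearestPoint (range α) (β (t i)) (α (u i))) ∧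
    Tendsto u atTop (𝓝 s)}

/-- The projection `π_α(b)` of a boundary point to a bi-infinite geodesic: the barycenter (center
of the smallest closed ball, here the midpoint of the smallest enclosing segment) of the set
`P_α(b)`. -/
def boundaryProj (α : GeodesicLine X) (b : VisualBoundary X) : X :=
  α ((sInf (boundaryProjParams α b) + sSup (boundaryProjParams α b)) / 2)

/-- The absolute value of the cross-ratio, `|[a,b,c,d]| = sup_{α ∈ (a,c)} d(π_α(b), π_α(d))`. -/
def absCrossRatio {x₀ : X} (a b c d : MorseBoundary X x₀) : ℝ :=
  ⨆ α : {α : GeodesicLine X // α.Joins a.toVisual c.toVisual},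
    dist (boundaryProj α.1 b.toVisual) (boundaryProj α.1 d.toVisual)

theorem absCrossRatio_nonneg {x₀ : X} (a b c d : MorseBoundary X x₀) :
    0 ≤ absCrossRatio a b c d :=
  Real.iSup_nonneg fun _ => dist_nonneg

end Boundary

section Maps

variable {X Y : Type*} [MetricSpace X] [MetricSpace Y] {x₀ : X} {y₀ : Y}

/-- `f` is 2-stable: it maps each `∂_* X^(2, D)` into some `∂_* Y^(2, D')`. -/
def IsTwoStable (f : MorseBoundary X x₀ → MorseBoundary Y y₀) : Prop :=
  ∀ D : ℝ≥0, ∃ D' : ℝ≥0, ∀ a ∈ contractingTuples x₀ 2 D, f ∘ a ∈ contractingTuples y₀ 2 D'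

/-- `f` is `D`-quasi-mobius. -/
def IsQuasiMobiusAt (D : ℝ≥0) (f : MorseBoundary X x₀ → MorseBoundary Y y₀) : Prop :=
  ∃ ψ : ℝ≥0 → ℝ≥0, Continuous ψ ∧ ∀ a ∈ contractingTuples x₀ 4 D,
    absCrossRatio (f (a 0)) (f (a 1)) (f (a 2)) (f (a 3)) ≤
      ψ ⟨absCrossRatio (a 0) (a 1) (a 2) (a 3), absCrossRatio_nonneg _ _ _ _⟩

/-- A homeomorphism `f` is quasi-mobius if `f` and its inverse are `D`-quasi-mobius for all `D`. -/
def IsQuasiMobius (f : MorseBoundary X x₀ ≃ₜ MorseBoundary Y y₀) : Prop :=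
  ∀ D : ℝ≥0, IsQuasiMobiusAt D f ∧ IsQuasiMobiusAt D f.symm

/-- `h` is a quasi-isometry (a coarsely surjective quasi-isometric embedding). -/
def IsQuasiIsometry (h : X → Y) : Prop :=
  ∃ L ε : ℝ, 1 ≤ L ∧ 0 ≤ ε ∧
    (∀ x x' : X, L⁻¹ * dist x x' - ε ≤ dist (h x) (h x') ∧
      dist (h x) (h x') ≤ L * dist x x' + ε) ∧
    ∀ y : Y, ∃ x : X, dist (h x) y ≤ ε

/-- `∂_* h = f`: if `α` represents `p ∈ ∂_* X`, then the rays that represent `f p` are those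
obtained by straightening `h ∘ α`, i.e. they lie at finite Hausdorff distance from `h ∘ α`. -/
def InducesOnMorseBoundary (h : X → Y) (f : MorseBoundary X x₀ → MorseBoundary Y y₀) : Prop :=
  ∀ (p : MorseBoundary X x₀) (α : GeodesicRay X) (β : GeodesicRay Y),
    α.endpoint = p.toVisual → β.endpoint = (f p).toVisual →
      hausdorffEDist (h '' range α) (range β) ≠ ⊤

end Maps

end

end MorseBdry

/-!
The proof replaces boundary points by coarse centers of ideal triangles, and turns the cross-ratio
condition into a statement about these centers.

**Contraction as a metric inequality.** `ProjGap C A` says that if `x`, `y` project to points `p`,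
`q` of `A` more than `C` apart, then `d(x, p) + d(p, q) + d(q, y) ≤ d(x, y) + C`. For geodesics in
CAT(0) spaces, whose projections are 1-Lipschitz, this is equivalent to contraction with
quantitative control of the constants (`IsContracting.projGap`, `ProjGap.isContracting`), and it is
easier to handle: it passes to subintervals, to sets at bounded Hausdorff distance, and from the two
halves of a line to the line; and it makes geodesics pass close to the points between the
projections of their ends (`ProjGap.exists_dist_le`).

**Geometry of the Morse boundary.** `Apart C o a b` says that the rays from `o` to `a` and `b` have
projection gaps and Gromov product at most `C`. All the lines from `a` to `b` then pass close to `o`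
and are contracting; conversely, a contracting line gives `Apart` at its points; two distinct rays
with projection gaps are `Apart` somewhere with a uniform constant (`RayGap.exists_apart`); and
Gromov products satisfy a hyperbolic inequality (`Apart.exchange`). A `Tripod` at `o` is a
triple of boundary points that are pairwise `Apart` at `o`, so that `o` is a coarse center of the
ideal triangle. Centers are coarsely unique because they are close to the projection of one vertex
to the opposite side (`Tripod.dist_boundaryProj_le`), and for the same reason the cross-ratio
`|[a, b, c, d]|` is, up to a bounded error, the distance between the centers of `a, b, c` and of
`a, d, c`. An ideal triangle with contracting sides has a center, with a uniform constant
(`MorseBoundary.exists_center`), so that 2-stable maps preserve the property of having one.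

**The quasi-isometry.** By cocompactness every point of `X` is a center of some triple, and `h` maps
it to a center of the image triple. This is coarsely well defined: if two triples have nearby
centers, then one can be changed into the other by exchanging one point at a time while keeping a
center at the same place. Each exchange changes the center of the image triple by a bounded amount,
since the cross-ratio of the four points involved is bounded (`exists_dist_center_le`). The same
holds for the inverse of `f`, so `h` is a quasi-isometry (`isQuasiIsometry_of_relation`).

**The boundary map.** Let `α` be a ray to `p`, and `q ≠ p`. Each `α t` is a center of a triangle
`q, p, s`, with `s` depending on `t`, so `h (α t)` is near the line from `f q` to `f p`. It stays on
the side of `f p`: for large `t`, the points `q` and `s` still diverge from a fixed third point `r`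
at `α 0`, hence `f q` and `f s` diverge near `h (α 0)`, and the projection of `f s` to the line
cannot lie far on the side of `f q` (`Tripod.param_le`).
-/

namespace MorseBdry

/-! ### Distances in CAT(0) spaces -/

section CAT0

variable {X : Type*} [MetricSpace X]

/-- `γ` is an isometric embedding on the set of parameters `I`, which is usually an interval; this
treats segments, rays and lines uniformly. -/
def GeodOn (γ : ℝ → X) (I : Set ℝ) : Prop :=
  ∀ s ∈ I, ∀ t ∈ I, dist (γ s) (γ t) = |s - t|

theorem GeodOn.mono {γ : ℝ → X} {I J : Set ℝ} (h : GeodOn γ I) (hJ : J ⊆ I) : GeodOn γ J :=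
  fun s hs t ht => h s (hJ hs) t (hJ ht)

theorem GeodOn.comp_add {γ : ℝ → X} {I J : Set ℝ} (h : GeodOn γ I) (a : ℝ)
    (hJ : ∀ t ∈ J, a + t ∈ I) : GeodOn (fun t => γ (a + t)) J := fun s hs t ht => by
  rw [h _ (hJ s hs) _ (hJ t ht)]; congr 1; ring

theorem GeodOn.comp_sub {γ : ℝ → X} {I J : Set ℝ} (h : GeodOn γ I) (a : ℝ)
    (hJ : ∀ t ∈ J, a - t ∈ I) : GeodOn (fun t => γ (a - t)) J := fun s hs t ht => by
  rw [h _ (hJ s hs) _ (hJ t ht), abs_sub_comm]; congr 1; ring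

/-- A Euclidean triangle with prescribed sides, with its first two vertices on a coordinate axis. -/
theorem exists_comparison_triangle (a b c : ℝ) (ha : 0 ≤ a) (hb : 0 ≤ b) (hc : 0 ≤ c)
    (h₁ : a ≤ b + c) (h₂ : b ≤ a + c) (h₃ : c ≤ a + b) :
    ∃ p q r : EuclideanSpace ℝ (Fin 2), dist p q = a ∧ dist q r = b ∧ dist p r = c := by
  rcases ha.eq_or_lt with rfl | ha
  · have hbc : b = c := by linarith
    refine ⟨!₂[0, 0], !₂[0, 0], !₂[c, 0], ?_, ?_, ?_⟩ <;>
      simp [EuclideanSpace.dist_eq, Real.dist_eq, hc, hbc]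
  · set u := (a ^ 2 + c ^ 2 - b ^ 2) / (2 * a) with hu
    have hua : 2 * a * u = a ^ 2 + c ^ 2 - b ^ 2 := by rw [hu]; field_simp
    have huc : 0 ≤ c ^ 2 - u ^ 2 := by
      have h4 : |u| ≤ c := by
        rw [abs_le]
        constructor
        · have : 0 ≤ 2 * a * (u + c) := by nlinarith
          have := nonneg_of_mul_nonneg_right this (by linarith); linarith
        · have : 0 ≤ 2 * a * (c - u) := by nlinarith
          have := nonneg_of_mul_nonneg_right this (by linarith); linarith
      nlinarith [sq_abs u, abs_nonneg u]
    have hv := Real.sq_sqrt huc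
    refine ⟨!₂[0, 0], !₂[a, 0], !₂[u, √(c ^ 2 - u ^ 2)], ?_, ?_, ?_⟩
    · simp [EuclideanSpace.dist_eq, Real.dist_eq, Real.sqrt_sq_eq_abs, abs_of_pos, ha]
    · rw [EuclideanSpace.dist_eq, Real.sqrt_eq_iff_mul_self_eq (by positivity) hb]
      simp only [Fin.sum_univ_two, Real.dist_eq, sq_abs]
      simp
      nlinarith
    · rw [EuclideanSpace.dist_eq, Real.sqrt_eq_iff_mul_self_eq (by positivity) hc]
      simp only [Fin.sum_univ_two, Real.dist_eq, sq_abs]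
      simp
      nlinarith

theorem exists_comparison_points (p q r : X) :
    ∃ p' q' r' : EuclideanSpace ℝ (Fin 2),
      dist p' q' = dist p q ∧ dist q' r' = dist q r ∧ dist p' r' = dist p r := by
  refine exists_comparison_triangle _ _ _ dist_nonneg dist_nonneg dist_nonneg ?_ ?_ ?_
  · rw [add_comm, dist_comm q r]; exact dist_triangle _ _ _
  · rw [dist_comm p q]; exact dist_triangle _ _ _
  · exact dist_triangle _ _ _

theorem GeodOn.dist_lineMap {γ : ℝ → X} {I : Set ℝ} (hγ : GeodOn γ I) [I.OrdConnected] {s t : ℝ}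
    (hs : s ∈ I) (ht : t ∈ I) {l : ℝ} (h0 : 0 ≤ l) (h1 : l ≤ 1) :
    s + l * (t - s) ∈ I ∧ dist (γ s) (γ (s + l * (t - s))) = l * dist (γ s) (γ t) ∧
      dist (γ (s + l * (t - s))) (γ t) = (1 - l) * dist (γ s) (γ t) := by
  have hm : s + l * (t - s) ∈ I := by
    refine OrdConnected.uIcc_subset ‹_› hs ht ?_
    rcases le_total s t with h | h
    · rw [uIcc_of_le h]; constructor <;> nlinarith
    · rw [uIcc_of_ge h]; constructor <;> nlinarith
  refine ⟨hm, ?_, ?_⟩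
  · rw [hγ _ hs _ hm, hγ _ hs _ ht]
    have : s - (s + l * (t - s)) = l * (s - t) := by ring
    rw [this, abs_mul, abs_of_nonneg h0]
  · have h1' : 0 ≤ 1 - l := by linarith
    have : s + l * (t - s) - t = (1 - l) * (s - t) := by ring
    rw [hγ _ hm _ ht, hγ _ hs _ ht, this, abs_mul, abs_of_nonneg h1']

variable [CAT0Space X]

/-- Points that divide two sides of a triangle from a common vertex in the same ratio are at most
as far apart as in a Euclidean triangle. -/
theorem dist_le_mul_of_ratio {p q r x y : X} {l : ℝ} (h0 : 0 ≤ l) (h1 : l ≤ 1)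
    (hpx : dist p x = l * dist p q) (hxq : dist x q = (1 - l) * dist p q)
    (hpy : dist p y = l * dist p r) (hyr : dist y r = (1 - l) * dist p r) :
    dist x y ≤ l * dist q r := by
  obtain ⟨p', q', r', h₁, h₂, h₃⟩ := exists_comparison_points p q r
  have hl : ‖l‖ = l := by rw [Real.norm_eq_abs, abs_of_nonneg h0]
  have hl' : ‖1 - l‖ = 1 - l := by rw [Real.norm_eq_abs, abs_of_nonneg (by linarith)]
  have key := CAT0Space.comparison p q r x y (by rw [hpx, hxq]; ring) (by rw [hpy, hyr]; ring)
    p' q' r' (AffineMap.lineMap p' q' l) (AffineMap.lineMap p' r' l) h₁ h₂ h₃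
    (by rw [dist_left_lineMap, hl, h₁, hpx]) (by rw [dist_lineMap_right, hl', h₁, hxq])
    (by rw [dist_left_lineMap, hl, h₃, hpy]) (by rw [dist_lineMap_right, hl', h₃, hyr])
  refine key.trans (le_of_eq ?_)
  rw [← h₂, AffineMap.lineMap_apply, AffineMap.lineMap_apply, dist_vadd_cancel_right, dist_smul₀,
    hl]
  simp

/-- The inequality of Bruhat and Tits, at the point that divides `[p, r]` in the ratio
`l : 1 - l`. -/
theorem dist_sq_le_of_ratio {p q r y : X} {l : ℝ} (h0 : 0 ≤ l) (h1 : l ≤ 1)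
    (hpy : dist p y = l * dist p r) (hyr : dist y r = (1 - l) * dist p r) :
    dist q y ^ 2 ≤ (1 - l) * dist q p ^ 2 + l * dist q r ^ 2 - l * (1 - l) * dist p r ^ 2 := by
  obtain ⟨p', q', r', h₁, h₂, h₃⟩ := exists_comparison_points p q r
  have hl : ‖l‖ = l := by rw [Real.norm_eq_abs, abs_of_nonneg h0]
  have hl' : ‖1 - l‖ = 1 - l := by rw [Real.norm_eq_abs, abs_of_nonneg (by linarith)]
  have key := CAT0Space.comparison p q r q y (by simp) (by rw [hpy, hyr]; ring)
    p' q' r' q' (AffineMap.lineMap p' r' l) h₁ h₂ h₃ h₁ (by simp)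
    (by rw [dist_left_lineMap, hl, h₃, hpy]) (by rw [dist_lineMap_right, hl', h₃, hyr])
  have h2 : dist q y ^ 2 ≤ dist q' (AffineMap.lineMap p' r' l) ^ 2 := by gcongr
  refine h2.trans (le_of_eq ?_)
  rw [dist_comm q p, ← h₁, ← h₂, ← h₃, dist_comm p' q', dist_eq_norm q' p', dist_eq_norm q' r',
    dist_comm p' r', dist_eq_norm r' p', dist_eq_norm]
  have e1 : q' - AffineMap.lineMap p' r' l = (q' - p') - l • (r' - p') := by
    rw [AffineMap.lineMap_apply]; simp; abel
  have e2 : q' - r' = (q' - p') - (r' - p') := by abel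
  rw [e1, e2, norm_sub_sq_real, norm_sub_sq_real (q' - p') (r' - p'), norm_smul, inner_smul_right,
    hl]
  ring

/-- In a quadrilateral, the squares of the diagonals add up to at most the sum of the squares of the
sides. -/
theorem dist_sq_add_dist_sq_le (x y q p : X) :
    dist x q ^ 2 + dist y p ^ 2 ≤
      dist x y ^ 2 + dist y q ^ 2 + dist q p ^ 2 + dist p x ^ 2 := by
  obtain ⟨γ, h0, h1, hγ⟩ := CAT0Space.geodesic y p
  obtain ⟨δ, k0, k1, hδ⟩ := CAT0Space.geodesic x q
  have hd := dist_nonneg (x := y) (y := p)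
  have hd' := dist_nonneg (x := x) (y := q)
  set n := γ (dist y p / 2) with hn
  set m := δ (dist x q / 2) with hm
  have a1 : dist y n = 1 / 2 * dist y p := by
    rw [← h0, hn, hγ _ ⟨le_rfl, hd⟩ _ ⟨by linarith, by linarith⟩, h0, abs_of_nonpos (by linarith)]
    ring
  have a2 : dist n p = (1 - 1 / 2) * dist y p := by
    nth_rw 1 [← h1]
    rw [hn, hγ _ ⟨by linarith, by linarith⟩ _ ⟨by linarith, le_rfl⟩, abs_of_nonpos (by linarith)]
    ring
  have b1 : dist x m = 1 / 2 * dist x q := by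
    rw [← k0, hm, hδ _ ⟨le_rfl, hd'⟩ _ ⟨by linarith, by linarith⟩, k0,
      abs_of_nonpos (by linarith)]
    ring
  have b2 : dist m q = (1 - 1 / 2) * dist x q := by
    nth_rw 1 [← k1]
    rw [hm, hδ _ ⟨by linarith, by linarith⟩ _ ⟨by linarith, le_rfl⟩, abs_of_nonpos (by linarith)]
    ring
  have c1 := dist_sq_le_of_ratio (q := x) (by norm_num) (by norm_num) a1 a2
  have c2 := dist_sq_le_of_ratio (q := q) (by norm_num) (by norm_num) a1 a2
  have c3 := dist_sq_le_of_ratio (q := n) (by norm_num) (by norm_num) b1 b2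
  rw [dist_comm n x, dist_comm n q] at c3
  rw [dist_comm y q, dist_comm p x]
  nlinarith [sq_nonneg (dist n m)]

/-- The distance between two geodesics, each parametrized proportionally to arc length, is
convex. -/
theorem dist_geod_geod_le {γ δ : ℝ → X} {I J : Set ℝ} [I.OrdConnected] [J.OrdConnected]
    (hγ : GeodOn γ I) (hδ : GeodOn δ J) {s t s' t' l : ℝ} (hs : s ∈ I) (ht : t ∈ I)
    (hs' : s' ∈ J) (ht' : t' ∈ J) (h0 : 0 ≤ l) (h1 : l ≤ 1) :
    dist (γ (s + l * (t - s))) (δ (s' + l * (t' - s'))) ≤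
      (1 - l) * dist (γ s) (δ s') + l * dist (γ t) (δ t') := by
  obtain ⟨σ, e0, e1, hσ⟩ := CAT0Space.geodesic (γ s) (δ t')
  set L := dist (γ s) (δ t')
  have hL : 0 ≤ L := dist_nonneg
  have hσ' : GeodOn σ (Icc 0 L) := hσ
  obtain ⟨_, a1, a2⟩ := hγ.dist_lineMap hs ht h0 h1
  obtain ⟨_, b1, b2⟩ := hδ.dist_lineMap hs' ht' h0 h1
  obtain ⟨_, c1, c2⟩ := hσ'.dist_lineMap (left_mem_Icc.2 hL) (right_mem_Icc.2 hL) h0 h1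
  rw [e0, e1] at c1 c2
  set x := γ (s + l * (t - s))
  set y := δ (s' + l * (t' - s'))
  set z := σ (0 + l * (L - 0))
  have k1 : dist x z ≤ l * dist (γ t) (δ t') := dist_le_mul_of_ratio h0 h1 a1 a2 c1 c2
  have k2 : dist z y ≤ (1 - l) * dist (γ s) (δ s') := by
    refine dist_le_mul_of_ratio (p := δ t') (by linarith) (by linarith) ?_ ?_ ?_ ?_
    · rw [dist_comm, c2, dist_comm (γ s)]
    · rw [dist_comm, c1, dist_comm (γ s)]; ring
    · rw [dist_comm, b2, dist_comm (δ s')]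
    · rw [dist_comm, b1, dist_comm (δ s')]; ring
  linarith [dist_triangle x z y]

theorem GeodOn.dist_le_max {γ : ℝ → X} {I : Set ℝ} (hγ : GeodOn γ I) [I.OrdConnected] {s t u : ℝ}
    (hs : s ∈ I) (hu : u ∈ I) (ht : t ∈ uIcc s u) (x : X) :
    dist x (γ t) ≤ max (dist x (γ s)) (dist x (γ u)) := by
  obtain ⟨l, h0, h1, rfl⟩ : ∃ l : ℝ, 0 ≤ l ∧ l ≤ 1 ∧ t = s + l * (u - s) := by
    rw [← segment_eq_uIcc, segment_eq_image] at ht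
    obtain ⟨l, hl, rfl⟩ := ht
    exact ⟨l, hl.1, hl.2, by simp; ring⟩
  have h := dist_geod_geod_le (γ := fun _ => x) (I := {0}) (s := 0) (t := 0)
    (by intro s hs t ht; simp_all) hγ rfl rfl hs hu h0 h1
  refine h.trans ?_
  nlinarith [le_max_left (dist x (γ s)) (dist x (γ u)),
    le_max_right (dist x (γ s)) (dist x (γ u))]

/-- Two geodesics that start close together and end at the same point stay close when both are
parametrized by arc length. -/
theorem dist_le_two_mul_of_common_end {γ δ : ℝ → X} {L M t : ℝ} (hγ : GeodOn γ (Icc 0 L))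
    (hδ : GeodOn δ (Ici 0)) (hM : 0 ≤ M) (hLM : γ L = δ M)
    (h0 : 0 ≤ t) (ht : t ≤ L) : dist (γ t) (δ t) ≤ 2 * dist (γ 0) (δ 0) := by
  rcases h0.eq_or_lt with rfl | htp
  · linarith [dist_nonneg (x := γ 0) (y := δ 0)]
  have hL : 0 < L := htp.trans_le ht
  have hl0 : 0 ≤ t / L := by positivity
  have hl1 : t / L ≤ 1 := by rw [div_le_one hL]; exact ht
  have key := dist_geod_geod_le hγ hδ (left_mem_Icc.2 hL.le) (right_mem_Icc.2 hL.le)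
    (mem_Ici.2 le_rfl) (mem_Ici.2 hM) hl0 hl1
  rw [hLM, dist_self] at key
  have e1 : 0 + t / L * (L - 0) = t := by field_simp; simp
  have e2 : 0 + t / L * (M - 0) = t / L * M := by ring
  rw [e1, e2] at key
  have h3 : dist (δ (t / L * M)) (δ t) ≤ dist (γ 0) (δ 0) := by
    rw [hδ _ (mem_Ici.2 (by positivity)) _ (mem_Ici.2 h0)]
    have : t / L * M - t = t / L * (M - L) := by field_simp
    rw [this, abs_mul, abs_of_nonneg hl0]
    have h4 : |M - L| ≤ dist (γ 0) (δ 0) := by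
      have a1 := hγ 0 (left_mem_Icc.2 hL.le) L (right_mem_Icc.2 hL.le)
      have a2 := hδ 0 (mem_Ici.2 le_rfl) M (mem_Ici.2 hM)
      rw [zero_sub, abs_neg, abs_of_nonneg (by linarith)] at a1 a2
      rw [abs_le]
      have t1 := dist_triangle (γ 0) (δ 0) (δ M)
      have t2 := dist_triangle (δ 0) (γ 0) (γ L)
      rw [dist_comm (δ 0) (γ 0)] at t2
      rw [hLM] at a1 t2
      constructor <;> linarith
    nlinarith [abs_nonneg (M - L)]
  have := dist_triangle (γ t) (δ (t / L * M)) (δ t)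
  nlinarith [dist_nonneg (x := γ 0) (y := δ 0)]

end CAT0

/-! ### Nearest points on geodesics -/

section Nearest

variable {X : Type*} [MetricSpace X]

theorem IsNearestPoint.dist_le {A : Set X} {x p q : X} (h : IsNearestPoint A x p) (hq : q ∈ A) :
    dist x p ≤ dist x q := h.2 ▸ infDist_le_dist_of_mem hq

theorem isNearestPoint_of_forall {A : Set X} {x p : X} (hp : p ∈ A)
    (h : ∀ q ∈ A, dist x p ≤ dist x q) : IsNearestPoint A x p :=
  ⟨hp, le_antisymm ((le_infDist ⟨p, hp⟩).2 fun q hq => h q hq) (infDist_le_dist_of_mem hp)⟩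

theorem isNearestPoint_self {A : Set X} {x : X} (hx : x ∈ A) : IsNearestPoint A x x :=
  isNearestPoint_of_forall hx fun q _ => by simp

theorem exists_isNearestPoint [ProperSpace X] {A : Set X} (hA : IsClosed A) (hne : A.Nonempty)
    (x : X) : ∃ p, IsNearestPoint A x p := by
  obtain ⟨p, hp, h⟩ := hA.exists_infDist_eq_dist hne x
  exact ⟨p, hp, h.symm⟩

theorem GeodOn.isClosed_image {γ : ℝ → X} {I : Set ℝ} (hγ : GeodOn γ I) (hI : IsClosed I) :
    IsClosed (γ '' I) := by
  have h : Isometry (fun t : I => γ t) := Isometry.of_dist_eq fun s t => by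
    rw [hγ _ s.2 _ t.2]; rfl
  have := hI.isComplete.completeSpace_coe
  rw [image_eq_range]
  exact h.isClosedEmbedding.isClosed_range

variable [CAT0Space X] {γ : ℝ → X} {I : Set ℝ} [I.OrdConnected]

/-- The angle at a nearest point is at least a right angle: the Bruhat-Tits inequality is applied at
points of `[p, q]` that tend to `p`. -/
theorem GeodOn.dist_sq_nearest (hγ : GeodOn γ I) {x p q : X} (hp : IsNearestPoint (γ '' I) x p)
    (hq : q ∈ γ '' I) : dist x p ^ 2 + dist p q ^ 2 ≤ dist x q ^ 2 := by
  obtain ⟨s, hs, rfl⟩ := hp.1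
  obtain ⟨t, ht, rfl⟩ := hq
  have key : ∀ l : ℝ, 0 < l → l ≤ 1 →
      dist x (γ s) ^ 2 + (1 - l) * dist (γ s) (γ t) ^ 2 ≤ dist x (γ t) ^ 2 := by
    intro l h0 h1
    obtain ⟨hm, a1, a2⟩ := hγ.dist_lineMap hs ht h0.le h1
    have h2 := dist_sq_le_of_ratio (q := x) h0.le h1 a1 a2
    have h3 := hp.dist_le (mem_image_of_mem γ hm)
    have h4 : dist x (γ s) ^ 2 ≤ dist x (γ (s + l * (t - s))) ^ 2 := by gcongr
    have h5 : l * (dist x (γ s) ^ 2 + (1 - l) * dist (γ s) (γ t) ^ 2) ≤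
      l * dist x (γ t) ^ 2 := by nlinarith
    exact le_of_mul_le_mul_left h5 h0
  have hlim : Tendsto (fun l : ℝ => dist x (γ s) ^ 2 + (1 - l) * dist (γ s) (γ t) ^ 2) (𝓝[>] 0)
      (𝓝 (dist x (γ s) ^ 2 + (1 - 0) * dist (γ s) (γ t) ^ 2)) := by
    apply Tendsto.mono_left _ nhdsWithin_le_nhds
    exact Continuous.tendsto (by fun_prop) 0
  rw [sub_zero, one_mul] at hlim
  refine le_of_tendsto hlim ?_
  filter_upwards [Ioc_mem_nhdsGT (zero_lt_one' ℝ)] with l hl using key l hl.1 hl.2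

/-- The nearest point projection to a geodesic does not increase distances. -/
theorem GeodOn.dist_nearest_le (hγ : GeodOn γ I) {x y p q : X}
    (hp : IsNearestPoint (γ '' I) x p) (hq : IsNearestPoint (γ '' I) y q) :
    dist p q ≤ dist x y := by
  have h1 := hγ.dist_sq_nearest hp hq.1
  have h2 := hγ.dist_sq_nearest hq hp.1
  have h3 := dist_sq_add_dist_sq_le x y q p
  rw [dist_comm q p, dist_comm p x] at h3
  rw [dist_comm q p] at h2
  have h4 : dist p q ^ 2 ≤ dist x y ^ 2 := by linarith
  exact (pow_le_pow_iff_left₀ dist_nonneg dist_nonneg two_ne_zero).1 h4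

theorem GeodOn.nearest_unique (hγ : GeodOn γ I) {x p q : X}
    (hp : IsNearestPoint (γ '' I) x p) (hq : IsNearestPoint (γ '' I) x q) : p = q :=
  dist_le_zero.1 ((hγ.dist_nearest_le hp hq).trans (dist_self x).le)

/-- The projection to a subinterval `J` factors through the projection to the whole geodesic:
the parameter is moved to the closest one in `J`. -/
theorem GeodOn.nearest_sub (hγ : GeodOn γ I) {J : Set ℝ} (hJ : J ⊆ I) {x : X} {s t : ℝ}
    (hs : s ∈ I) (hn : IsNearestPoint (γ '' I) x (γ s)) (ht : t ∈ J)
    (hst : ∀ j ∈ J, t ∈ uIcc s j) : IsNearestPoint (γ '' J) x (γ t) := by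
  refine isNearestPoint_of_forall (mem_image_of_mem γ ht) ?_
  rintro _ ⟨j, hj, rfl⟩
  refine (hγ.dist_le_max hs (hJ hj) (hst j hj) x).trans ?_
  rw [max_eq_right (hn.dist_le (mem_image_of_mem γ (hJ hj)))]

end Nearest

/-! ### The projection gap inequality -/

section Gap

variable {X : Type*} [MetricSpace X]

/-- The metric form in which contraction is used: if the projections `p`, `q` of `x`, `y` to `A`
are more than `C` apart, then the path `x, p, q, y` is shortest up to an error of `C`. -/
def ProjGap (C : ℝ) (A : Set X) : Prop :=
  ∀ x y p q : X, IsNearestPoint A x p → IsNearestPoint A y q → C < dist p q →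
    dist x p + dist p q + dist q y ≤ dist x y + C

theorem ProjGap.mono {C C' : ℝ} {A : Set X} (h : ProjGap C A) (hC : C ≤ C') : ProjGap C' A :=
  fun x y p q hp hq hpq => (h x y p q hp hq (hC.trans_lt hpq)).trans (by linarith)

theorem ProjGap.dist_add_le {C : ℝ} {A : Set X} (h : ProjGap C A) {x p y : X}
    (hp : IsNearestPoint A x p) (hy : y ∈ A) : dist x p + dist p y ≤ dist x y + C := by
  rcases lt_or_ge C (dist p y) with h1 | h1
  · simpa using h x y p y hp (isNearestPoint_self hy) h1
  · linarith [hp.dist_le hy]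

/-- A point that is closer to `x` than `A` is, up to `C`, has nearly the same projection. -/
theorem ProjGap.dist_nearest_le {C : ℝ} {A : Set X} (h : ProjGap C A) {x y p q : X}
    (hp : IsNearestPoint A x p) (hq : IsNearestPoint A y q) (hxy : dist x y ≤ dist x p) :
    dist p q ≤ C := by
  by_contra! hlt
  linarith [h x y p q hp hq hlt, dist_nonneg (x := q) (y := y)]

theorem ProjGap.isContracting [ProperSpace X] {C : ℝ≥0} {A : Set X} (h : ProjGap C A)
    (hA : IsClosed A) : IsContracting (2 * C) A := by
  intro x r hdisj y hy z hz p q hp hq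
  obtain ⟨o, ho⟩ := exists_isNearestPoint hA ⟨p, hp.1⟩ x
  have hr : r ≤ dist x o := by
    by_contra! hlt
    exact disjoint_left.1 hdisj (by rwa [mem_ball, dist_comm]) ho.1
  rw [mem_ball, dist_comm] at hy hz
  have h1 := h.dist_nearest_le ho hp (by linarith)
  have h2 := h.dist_nearest_le ho hq (by linarith)
  push_cast
  linarith [dist_triangle p o q, dist_comm o p]

/-- Projection gaps pass to sets at finite Hausdorff distance. -/
theorem ProjGap.of_close [ProperSpace X] {C K : ℝ} {A B : Set X} (h : ProjGap C A)
    (hA : IsClosed A) (hAB : ∀ a ∈ A, ∃ b ∈ B, dist a b ≤ K)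
    (hBA : ∀ b ∈ B, ∃ a ∈ A, dist a b ≤ K) : ProjGap (3 * C + 8 * K) B := by
  have near : ∀ x p p', IsNearestPoint A x p → IsNearestPoint B x p' → dist p p' ≤ C + 3 * K := by
    intro x p p' hp hp'
    obtain ⟨a, ha, hap⟩ := hBA p' hp'.1
    obtain ⟨b, hb, hpb⟩ := hAB p hp.1
    linarith [h.dist_add_le hp ha, hp'.dist_le hb, dist_triangle x p b, dist_triangle x p' a,
      dist_triangle p a p', dist_comm p' a]
  have near' : ∀ x p p', IsNearestPoint A x p → IsNearestPoint B x p' →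
      dist x p' ≤ dist x p + K := by
    intro x p p' hp hp'
    obtain ⟨b, hb, hpb⟩ := hAB p hp.1
    linarith [hp'.dist_le hb, dist_triangle x p b]
  intro x y p' q' hp' hq' hlt
  obtain ⟨a₀, ha₀, h₀⟩ := hBA p' hp'.1
  obtain ⟨p, hp⟩ := exists_isNearestPoint hA ⟨a₀, ha₀⟩ x
  obtain ⟨q, hq⟩ := exists_isNearestPoint hA ⟨a₀, ha₀⟩ y
  have hK : 0 ≤ K := dist_nonneg.trans h₀
  have n1 := near x p p' hp hp'
  have n2 := near y q q' hq hq'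
  have n3 := near' x p p' hp hp'
  have n4 := near' y q q' hq hq'
  have hC : 0 ≤ C := by
    have := h.dist_add_le hp hp.1
    simp at this; exact this
  have t1 := dist_triangle4 p' p q q'
  rw [dist_comm p' p] at t1
  have := h x y p q hp hq (by linarith)
  rw [dist_comm q y] at this
  rw [dist_comm q' y]
  linarith

variable [CAT0Space X]

/-- Along a geodesic from `x` to `y`, the projection moves by at most `D` while the geodesic is in
the ball around `x` that is disjoint from `A`, likewise near `y`, and it is 1-Lipschitz in between. -/
theorem IsContracting.projGap {γ : ℝ → X} {I : Set ℝ} [I.OrdConnected]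
    [ProperSpace X] (hγ : GeodOn γ I)
    (hI : IsClosed I) {D : ℝ≥0} (h : IsContracting D (γ '' I)) :
    ProjGap (2 * D + 2) (γ '' I) := by
  -- Points of a geodesic from `x` at distance less than `d(x, A)` project close to `p`.
  have step : ∀ x p, IsNearestPoint (γ '' I) x p → ∀ z q, IsNearestPoint (γ '' I) z q →
      dist x z < dist x p → dist p q ≤ D := by
    intro x p hp z q hq hz
    refine h x (dist x p) ?_ x ?_ z ?_ p q hp hq
    · rw [disjoint_left]
      intro w hw hwA
      rw [mem_ball, dist_comm] at hw
      linarith [hp.dist_le hwA]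
    · rw [mem_ball, dist_self]; exact dist_nonneg.trans_lt hz
    · rwa [mem_ball, dist_comm]
  have hD : (0 : ℝ) ≤ D := D.2
  intro x y p q hp hq hlt
  obtain ⟨σ, h0, h1, hσ⟩ := CAT0Space.geodesic x y
  set L := dist x y with hL
  have hx := dist_nonneg (x := x) (y := p)
  have hy := dist_nonneg (x := y) (y := q)
  -- The balls in the definition of contraction are open: staying 1 below the radius costs 2.
  set r := max (dist x p - 1) 0 with hr
  set r' := max (dist y q - 1) 0 with hr'
  have hr1 : dist x p - 1 ≤ r := le_max_left _ _
  have hr1' : dist y q - 1 ≤ r' := le_max_left _ _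
  have hr0 : 0 ≤ r := le_max_right _ _
  have hr0' : 0 ≤ r' := le_max_right _ _
  have hLpq : dist p q ≤ L := hγ.dist_nearest_le hp hq
  -- The projections of `x` and of the point of the geodesic at distance `r` from it.
  have near : ∀ x p, IsNearestPoint (γ '' I) x p → ∀ z q, IsNearestPoint (γ '' I) z q →
      dist x z ≤ max (dist x p - 1) 0 → dist p q ≤ D := by
    intro x p hp z q hq hz
    rcases le_total (dist x p - 1) 0 with hle | hle
    · rw [max_eq_right hle] at hz
      have : x = z := dist_le_zero.1 hz
      subst this
      rw [hγ.nearest_unique hp hq, dist_self]; exact hD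
    · rw [max_eq_left hle] at hz
      exact step x p hp z q hq (by linarith)
  have ex : ∀ z, ∃ w, IsNearestPoint (γ '' I) z w :=
    exists_isNearestPoint (hγ.isClosed_image hI) ⟨p, hp.1⟩
  by_cases hrr : r + r' ≤ L
  · have m0 : (0 : ℝ) ∈ Icc 0 L := ⟨le_rfl, dist_nonneg⟩
    have mL : L ∈ Icc 0 L := ⟨dist_nonneg, le_rfl⟩
    have mr : r ∈ Icc 0 L := ⟨hr0, by linarith⟩
    have mr' : L - r' ∈ Icc 0 L := ⟨by linarith, by linarith⟩
    obtain ⟨u, hu⟩ := ex (σ r)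
    obtain ⟨v, hv⟩ := ex (σ (L - r'))
    have e1 := near x p hp _ u hu (by
      rw [← h0, hσ _ m0 _ mr, h0, abs_of_nonpos (by linarith)]; linarith)
    have e2 := near y q hq _ v hv (by
      nth_rw 1 [← h1]
      rw [hσ _ mL _ mr', abs_of_nonneg (by linarith)]; linarith)
    have e3 := hγ.dist_nearest_le hu hv
    rw [hσ _ mr _ mr', abs_of_nonpos (by linarith)] at e3
    have := dist_triangle4 p u v q
    rw [dist_comm v q] at this
    rw [dist_comm q y]
    linarith
  · push Not at hrr
    -- The two balls overlap: their common point projects close to both `p` and `q`.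
    have hmid : ∃ z, dist x z ≤ r ∧ dist y z ≤ r' := by
      rcases le_total r L with hrL | hrL
      · have mr : r ∈ Icc 0 L := ⟨hr0, hrL⟩
        refine ⟨σ r, ?_, ?_⟩
        · rw [← h0, hσ _ ⟨le_rfl, dist_nonneg⟩ _ mr, abs_of_nonpos (by linarith)]; linarith
        · rw [← h1, hσ _ ⟨dist_nonneg, le_rfl⟩ _ mr, abs_of_nonneg (by linarith)]; linarith
      · exact ⟨y, hrL, by rw [dist_self]; exact hr0'⟩
    obtain ⟨z, hz1, hz2⟩ := hmid
    obtain ⟨w, hw⟩ := ex z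
    have e1 := near x p hp z w hw hz1
    have e2 := near y q hq z w hw hz2
    have := dist_triangle p w q
    rw [dist_comm w q] at this
    linarith

/-- A geodesic `σ` whose end points project to two points of `γ` far apart passes close to every
point of `γ` well between these projections: the point of `σ` that projects to `γ t` works. -/
theorem ProjGap.exists_dist_le [ProperSpace X] {γ : ℝ → X} {I : Set ℝ} [I.OrdConnected] {C : ℝ}
    (h : ProjGap C (γ '' I)) (hγ : GeodOn γ I) (hI : IsClosed I) {σ : ℝ → X} {a b s t u : ℝ}
    (hab : a ≤ b)
    (hσ : GeodOn σ (Icc a b)) (hs : s ∈ I) (hu : u ∈ I)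
    (ns : IsNearestPoint (γ '' I) (σ a) (γ s)) (nu : IsNearestPoint (γ '' I) (σ b) (γ u))
    (ht : t ∈ uIcc s u) (hst : C < |s - t|) (htu : C < |t - u|) :
    ∃ v ∈ Icc a b, dist (σ v) (γ t) ≤ C := by
  have htI : t ∈ I := OrdConnected.uIcc_subset ‹_› hs hu ht
  have ex : ∀ z, ∃ w ∈ I, IsNearestPoint (γ '' I) z (γ w) := by
    intro z
    obtain ⟨p, hp⟩ := exists_isNearestPoint (hγ.isClosed_image hI) ⟨_, ns.1⟩ z
    obtain ⟨w, hw, rfl⟩ := hp.1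
    exact ⟨w, hw, hp⟩
  choose f hfI hf using fun z => ex (σ z)
  have inj : ∀ w ∈ I, ∀ w' ∈ I, γ w = γ w' → w = w' := by
    intro w hw w' hw' e
    have := hγ w hw w' hw'
    rw [e, dist_self, eq_comm, abs_eq_zero] at this
    linarith
  have fa : f a = s := inj _ (hfI _) _ hs (hγ.nearest_unique (hf a) ns)
  have fb : f b = u := inj _ (hfI _) _ hu (hγ.nearest_unique (hf b) nu)
  have hcont : ContinuousOn f (Icc a b) := by
    refine LipschitzOnWith.continuousOn (K := 1) (LipschitzOnWith.of_dist_le_mul ?_)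
    intro v hv w hw
    rw [Real.dist_eq, ← hγ _ (hfI v) _ (hfI w), NNReal.coe_one, one_mul, Real.dist_eq,
      ← hσ v hv w hw]
    exact hγ.dist_nearest_le (hf v) (hf w)
  obtain ⟨v, hv, rfl⟩ : ∃ v ∈ Icc a b, f v = t := by
    have := intermediate_value_uIcc (a := a) (b := b) (f := f) (by rwa [uIcc_of_le hab])
    rw [fa, fb, uIcc_of_le hab] at this
    exact this ht
  refine ⟨v, hv, ?_⟩
  have g1 := h _ _ _ _ ns (hf v) (by rwa [hγ _ hs _ htI])
  have g2 := h _ _ _ _ (hf v) nu (by rwa [hγ _ htI _ hu])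
  have t1 := dist_triangle4 (σ a) (γ s) (γ (f v)) (σ b)
  have t2 := dist_triangle4 (γ s) (γ (f v)) (γ u) (σ b)
  have t3 := dist_triangle (σ a) (γ s) (σ b)
  have e1 := hσ a (left_mem_Icc.2 hab) v hv
  have e2 := hσ v hv b (right_mem_Icc.2 hab)
  have e3 := hσ a (left_mem_Icc.2 hab) b (right_mem_Icc.2 hab)
  rw [abs_of_nonpos (by linarith [hv.1])] at e1
  rw [abs_of_nonpos (by linarith [hv.2])] at e2
  rw [abs_of_nonpos (by linarith [hv.2])] at e3
  rw [dist_comm (γ (f v)) (σ v)] at g1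
  linarith

/-- Subintervals inherit the projection gap, with the same constant. -/
theorem ProjGap.sub [ProperSpace X] {γ : ℝ → X} {I J : Set ℝ} [I.OrdConnected] [J.OrdConnected]
    {C : ℝ} (h : ProjGap C (γ '' I)) (hγ : GeodOn γ I) (hI : IsClosed I) (hJ : J ⊆ I)
    (hJI : ∀ s ∈ I, ∃ t ∈ J, ∀ j ∈ J, t ∈ uIcc s j) : ProjGap C (γ '' J) := by
  intro x y p q hp hq hlt
  have hne : (γ '' I).Nonempty := (Nonempty.mono (image_mono hJ)) ⟨p, hp.1⟩
  obtain ⟨p', hp'⟩ := exists_isNearestPoint (hγ.isClosed_image hI) hne x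
  obtain ⟨q', hq'⟩ := exists_isNearestPoint (hγ.isClosed_image hI) hne y
  obtain ⟨s, hs, rfl⟩ := hp'.1
  obtain ⟨u, hu, rfl⟩ := hq'.1
  obtain ⟨t, ht, hst⟩ := hJI s hs
  obtain ⟨v, hv, huv⟩ := hJI u hu
  have ep := (hγ.mono hJ).nearest_unique hp (hγ.nearest_sub hJ hs hp' ht hst)
  have eq := (hγ.mono hJ).nearest_unique hq (hγ.nearest_sub hJ hu hq' hv huv)
  subst ep eq
  have d1 := hst v hv
  have d2 := huv t ht
  have e1 := hγ s hs t (hJ ht)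
  have e2 := hγ t (hJ ht) v (hJ hv)
  have e3 := hγ u hu v (hJ hv)
  have e4 := hγ s hs u hu
  -- `t` and `v` lie in this order between `s` and `u`, unless they coincide.
  have key : |s - u| = |s - t| + |t - v| + |u - v| ∨ t = v := by
    rw [mem_uIcc] at d1 d2
    rcases d1 with ⟨a1, a2⟩ | ⟨a1, a2⟩ <;> rcases d2 with ⟨b1, b2⟩ | ⟨b1, b2⟩
    · right; linarith
    · left
      rw [abs_of_nonpos (by linarith), abs_of_nonpos (by linarith), abs_of_nonpos (by linarith),
        abs_of_nonneg (by linarith)]; ring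
    · left
      rw [abs_of_nonneg (by linarith), abs_of_nonneg (by linarith), abs_of_nonneg (by linarith),
        abs_of_nonpos (by linarith)]; ring
    · right; linarith
  have hC : 0 ≤ C := by
    have := h.dist_add_le hp' hp'.1
    simp at this; exact this
  rcases key with key | rfl
  · have hle : dist (γ t) (γ v) ≤ dist (γ s) (γ u) := by
      rw [e2, e4, key]; linarith [abs_nonneg (s - t), abs_nonneg (u - v)]
    have := h x y _ _ hp' hq' (hlt.trans_le hle)
    have t1 := dist_triangle x (γ s) (γ t)
    have t2 := dist_triangle (γ v) (γ u) y
    rw [dist_comm (γ v) (γ u)] at t2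
    linarith
  · rw [dist_self] at hlt; linarith

theorem ProjGap.ici [ProperSpace X] {γ : ℝ → X} {I : Set ℝ} [I.OrdConnected]
    {C : ℝ} (h : ProjGap C (γ '' I)) (hγ : GeodOn γ I) (hI : IsClosed I) {a : ℝ}
    (hJ : Ici a ⊆ I) : ProjGap C (γ '' Ici a) := by
  refine h.sub hγ hI hJ fun s _ => ⟨max s a, mem_Ici.2 (le_max_right _ _), fun j hj => ?_⟩
  rw [mem_uIcc]
  rw [mem_Ici] at hj
  grind

theorem ProjGap.iic [ProperSpace X] {γ : ℝ → X} {I : Set ℝ} [I.OrdConnected]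
    {C : ℝ} (h : ProjGap C (γ '' I)) (hγ : GeodOn γ I) (hI : IsClosed I) {a : ℝ}
    (hJ : Iic a ⊆ I) : ProjGap C (γ '' Iic a) := by
  refine h.sub hγ hI hJ fun s _ => ⟨min s a, mem_Iic.2 (min_le_right _ _), fun j hj => ?_⟩
  rw [mem_uIcc]
  rw [mem_Iic] at hj
  grind

/-- A line has a projection gap if its two halves do: a path between points that project to
different halves behaves as if it passed through the common point of the halves. -/
theorem ProjGap.of_halves [ProperSpace X] {γ : ℝ → X} {C : ℝ} (hγ : GeodOn γ univ) {a : ℝ}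
    (h₁ : ProjGap C (γ '' Iic a)) (h₂ : ProjGap C (γ '' Ici a)) : ProjGap (2 * C) (γ '' univ) := by
  have hC : 0 ≤ C := by
    have := h₁.dist_add_le (isNearestPoint_self (mem_image_of_mem γ (mem_Iic.2 le_rfl)))
      (mem_image_of_mem γ (mem_Iic.2 le_rfl))
    simp at this; exact this
  -- The projection to a half that misses the projection to the line is the point `γ a`.
  have main : ∀ x y : X, ∀ s u : ℝ, s ≤ u → IsNearestPoint (γ '' univ) x (γ s) →
      IsNearestPoint (γ '' univ) y (γ u) → 2 * C < dist (γ s) (γ u) →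
      dist x (γ s) + dist (γ s) (γ u) + dist (γ u) y ≤ dist x y + 2 * C := by
    intro x y s u hsu hx hy hlt
    have sub : ∀ (J : Set ℝ) (z : X) (s t : ℝ), IsNearestPoint (γ '' univ) z (γ s) → t ∈ J →
        (∀ j ∈ J, t ∈ uIcc s j) → IsNearestPoint (γ '' J) z (γ t) := fun J z s t hn ht hst =>
      hγ.nearest_sub (subset_univ J) (mem_univ s) hn ht hst
    rcases le_total u a with hua | hua
    · have := h₁ x y _ _ (sub _ x s s hx (mem_Iic.2 (hsu.trans hua)) fun j _ => left_mem_uIcc)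
        (sub _ y u u hy (mem_Iic.2 hua) fun j _ => left_mem_uIcc) (by linarith)
      linarith
    rcases le_total a s with has | has
    · have := h₂ x y _ _ (sub _ x s s hx (mem_Ici.2 has) fun j _ => left_mem_uIcc)
        (sub _ y u u hy (mem_Ici.2 hua) fun j _ => left_mem_uIcc) (by linarith)
      linarith
    have x1 := sub (Iic a) x s s hx (mem_Iic.2 has) fun j _ => left_mem_uIcc
    have y1 := sub (Ici a) y u u hy (mem_Ici.2 hua) fun j _ => left_mem_uIcc
    have x2 := sub (Ici a) x s a hx (mem_Ici.2 le_rfl) fun j hj => mem_uIcc.2 (Or.inl ⟨has, hj⟩)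
    have y2 := sub (Iic a) y u a hy (mem_Iic.2 le_rfl) fun j hj => mem_uIcc.2 (Or.inr ⟨hj, hua⟩)
    have d1 := h₁.dist_add_le x1 (mem_image_of_mem γ (mem_Iic.2 (le_refl a)))
    have d2 := h₂.dist_add_le y1 (mem_image_of_mem γ (mem_Ici.2 (le_refl a)))
    have t1 := dist_triangle (γ s) (γ a) (γ u)
    rw [dist_comm (γ u) (γ a), dist_comm y (γ u), dist_comm y (γ a)] at d2
    rcases lt_or_ge C (dist (γ s) (γ a)) with h3 | h3
    · have := h₁ x y _ _ x1 y2 h3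
      linarith
    · have := h₂ x y _ _ x2 y1 (by linarith)
      linarith
  intro x y p q hp hq hlt
  obtain ⟨s, _, rfl⟩ := hp.1
  obtain ⟨u, _, rfl⟩ := hq.1
  rcases le_total s u with hsu | hsu
  · exact main x y s u hsu hp hq hlt
  · have := main y x u s hsu hq hp (by rwa [dist_comm])
    rw [dist_comm y x, dist_comm y, dist_comm (γ u) (γ s), dist_comm (γ s) x] at this
    linarith

end Gap

/-! ### Rays to a boundary point -/

section Rays

variable {X : Type*} [MetricSpace X]

theorem hausdorffEDist_ne_top_iff {A B : Set X} :
    hausdorffEDist A B ≠ ⊤ ↔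
      ∃ N : ℝ, (∀ a ∈ A, ∃ b ∈ B, dist a b ≤ N) ∧ ∀ b ∈ B, ∃ a ∈ A, dist a b ≤ N := by
  constructor
  · intro h
    obtain ⟨r, hr⟩ := ENNReal.lt_iff_exists_nnreal_btwn.1 (lt_top_iff_ne_top.2 h)
    have conv : ∀ x y : X, edist x y < r → dist x y ≤ r := fun x y hxy => by
      rw [edist_nndist, ENNReal.coe_lt_coe] at hxy
      exact_mod_cast hxy.le
    refine ⟨r, fun a ha => ?_, fun b hb => ?_⟩
    · obtain ⟨b, hb, hab⟩ := exists_edist_lt_of_hausdorffEDist_lt ha hr.1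
      exact ⟨b, hb, conv _ _ hab⟩
    · rw [hausdorffEDist_comm] at hr
      obtain ⟨a, ha, hab⟩ := exists_edist_lt_of_hausdorffEDist_lt hb hr.1
      rw [edist_comm] at hab
      exact ⟨a, ha, conv _ _ hab⟩
  · rintro ⟨N, h₁, h₂⟩
    have conv : ∀ x y : X, dist x y ≤ N → edist x y ≤ ENNReal.ofReal N := fun x y hxy => by
      rw [edist_dist]; exact ENNReal.ofReal_le_ofReal hxy
    refine ne_top_of_le_ne_top (ENNReal.ofReal_ne_top (r := N))
      (hausdorffEDist_le_of_mem_edist (fun a ha => ?_) fun b hb => ?_)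
    · obtain ⟨b, hb, hab⟩ := h₁ a ha
      exact ⟨b, hb, conv _ _ hab⟩
    · obtain ⟨a, ha, hab⟩ := h₂ b hb
      exact ⟨a, ha, by rw [edist_comm]; exact conv _ _ hab⟩

/-- A geodesic ray with real parameters; only the values at nonnegative parameters matter. -/
def GeodesicRay.real (β : GeodesicRay X) : ℝ → X := fun t => β t.toNNReal

theorem GeodesicRay.real_coe (β : GeodesicRay X) (t : ℝ≥0) : β.real t = β t := by
  simp [GeodesicRay.real]

theorem GeodesicRay.geodOn (β : GeodesicRay X) : GeodOn β.real (Ici 0) := by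
  intro s hs t ht
  rw [GeodesicRay.real, GeodesicRay.real, β.isometry.dist_eq, NNReal.dist_eq,
    Real.coe_toNNReal _ hs, Real.coe_toNNReal _ ht]

theorem GeodesicRay.image_real (β : GeodesicRay X) : β.real '' Ici 0 = range β := by
  ext x
  constructor
  · rintro ⟨t, _, rfl⟩; exact ⟨_, rfl⟩
  · rintro ⟨t, rfl⟩; exact ⟨t, t.2, β.real_coe t⟩

theorem GeodesicLine.geodOn (α : GeodesicLine X) : GeodOn α univ := fun s _ t _ => by
  rw [α.isometry.dist_eq, Real.dist_eq]

theorem GeodesicLine.isClosed_range (α : GeodesicLine X) : IsClosed (range α) := by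
  rw [← image_univ]; exact α.geodOn.isClosed_image isClosed_univ

theorem GeodesicLine.dist_eq (α : GeodesicLine X) (s t : ℝ) : dist (α s) (α t) = |s - t| :=
  α.geodOn s trivial t trivial

/-- The geodesic ray with a given real parametrization. -/
def GeodOn.toRay {γ : ℝ → X} (h : GeodOn γ (Ici 0)) : GeodesicRay X where
  toFun t := γ t
  isometry := Isometry.of_dist_eq fun s t => by
    rw [h _ s.coe_nonneg _ t.coe_nonneg]; rfl

theorem GeodOn.toRay_apply {γ : ℝ → X} (h : GeodOn γ (Ici 0)) (t : ℝ≥0) : h.toRay t = γ t := rfl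

theorem GeodOn.range_toRay {γ : ℝ → X} (h : GeodOn γ (Ici 0)) : range h.toRay = γ '' Ici 0 := by
  ext x
  constructor
  · rintro ⟨t, rfl⟩; exact ⟨t, t.2, rfl⟩
  · rintro ⟨t, ht, rfl⟩; exact ⟨⟨t, ht⟩, rfl⟩

theorem endpoint_eq_iff {β β' : GeodesicRay X} :
    β.endpoint = β'.endpoint ↔ ∃ N : ℝ, ∀ t : ℝ, 0 ≤ t → dist (β.real t) (β'.real t) ≤ N := by
  have h0 : β.endpoint = β'.endpoint ↔ hausdorffEDist (range β) (range β') ≠ ⊤ := by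
    rw [GeodesicRay.endpoint, GeodesicRay.endpoint]
    exact Quotient.eq (r := asymptoticSetoid X)
  rw [h0, hausdorffEDist_ne_top_iff]
  constructor
  · rintro ⟨N, h₁, -⟩
    refine ⟨2 * N + dist (β.real 0) (β'.real 0), fun t ht => ?_⟩
    obtain ⟨_, ⟨s, rfl⟩, hs⟩ := h₁ _ ⟨t.toNNReal, rfl⟩
    have e1 := β.geodOn 0 (mem_Ici.2 le_rfl) t ht
    have e2 := β'.geodOn 0 (mem_Ici.2 le_rfl) s s.2
    have e3 := β'.geodOn s s.2 t ht
    rw [zero_sub, abs_neg, abs_of_nonneg ht] at e1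
    rw [zero_sub, abs_neg, abs_of_nonneg s.coe_nonneg] at e2
    rw [← β'.real_coe] at hs
    change dist (β.real t) _ ≤ N at hs
    have t1 := dist_triangle4 (β.real 0) (β'.real 0) (β'.real s) (β.real t)
    have t2 := dist_triangle4 (β'.real 0) (β.real 0) (β.real t) (β'.real s)
    have t3 := dist_triangle (β.real t) (β'.real s) (β'.real t)
    rw [dist_comm (β'.real s) (β.real t)] at t1
    rw [dist_comm (β'.real 0) (β.real 0)] at t2
    have : |(s : ℝ) - t| ≤ N + dist (β.real 0) (β'.real 0) := by
      rw [abs_le]; constructor <;> linarith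
    linarith
  · rintro ⟨N, h⟩
    refine ⟨N, ?_, ?_⟩
    · rintro _ ⟨t, rfl⟩
      have := h t t.2
      rw [β.real_coe, β'.real_coe] at this
      exact ⟨_, ⟨t, rfl⟩, this⟩
    · rintro _ ⟨t, rfl⟩
      have := h t t.2
      rw [β.real_coe, β'.real_coe] at this
      exact ⟨_, ⟨t, rfl⟩, this⟩

/-- `γ`, restricted to nonnegative parameters, is a geodesic ray that represents `ξ`. -/
def IsRayTo (γ : ℝ → X) (ξ : VisualBoundary X) : Prop :=
  GeodOn γ (Ici 0) ∧ ∃ β : GeodesicRay X, β.endpoint = ξ ∧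
    ∃ N : ℝ, ∀ t : ℝ, 0 ≤ t → dist (γ t) (β.real t) ≤ N

theorem GeodesicRay.isRayTo (β : GeodesicRay X) : IsRayTo β.real β.endpoint :=
  ⟨β.geodOn, β, rfl, 0, fun t _ => by simp⟩

theorem IsRayTo.of_bounded {γ δ : ℝ → X} {ξ : VisualBoundary X} (h : IsRayTo γ ξ)
    (hδ : GeodOn δ (Ici 0)) {N : ℝ} (hN : ∀ t, 0 ≤ t → dist (δ t) (γ t) ≤ N) : IsRayTo δ ξ := by
  obtain ⟨_, β, hβ, M, hM⟩ := h
  exact ⟨hδ, β, hβ, N + M, fun t ht =>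
    (dist_triangle _ (γ t) _).trans (add_le_add (hN t ht) (hM t ht))⟩

theorem IsRayTo.endpoint_toRay {γ : ℝ → X} {ξ : VisualBoundary X} (h : IsRayTo γ ξ) :
    h.1.toRay.endpoint = ξ := by
  obtain ⟨hγ, β, rfl, N, hN⟩ := h
  refine endpoint_eq_iff.2 ⟨N, fun t ht => ?_⟩
  have : hγ.toRay.real t = γ t := by
    rw [GeodesicRay.real, GeodOn.toRay_apply, Real.coe_toNNReal _ ht]
  rw [this]; exact hN t ht

theorem IsRayTo.bounded {γ δ : ℝ → X} {ξ : VisualBoundary X} (h : IsRayTo γ ξ)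
    (h' : IsRayTo δ ξ) : ∃ N : ℝ, ∀ t, 0 ≤ t → dist (γ t) (δ t) ≤ N := by
  obtain ⟨_, β, hβ, M, hM⟩ := h
  obtain ⟨_, β', hβ', M', hM'⟩ := h'
  obtain ⟨N, hN⟩ := endpoint_eq_iff.1 (hβ.trans hβ'.symm)
  refine ⟨M + N + M', fun t ht => ?_⟩
  have := dist_triangle4 (γ t) (β.real t) (β'.real t) (δ t)
  rw [dist_comm (β'.real t) (δ t)] at this
  linarith [hM t ht, hN t ht, hM' t ht]

theorem IsRayTo.unique {γ : ℝ → X} {ξ ξ' : VisualBoundary X} (h : IsRayTo γ ξ)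
    (h' : IsRayTo γ ξ') : ξ = ξ' := h.endpoint_toRay.symm.trans h'.endpoint_toRay

theorem IsRayTo.comp_add {γ : ℝ → X} {ξ : VisualBoundary X} (h : IsRayTo γ ξ) {s : ℝ}
    (hs : 0 ≤ s) : IsRayTo (fun t => γ (s + t)) ξ := by
  refine h.of_bounded (h.1.comp_add s fun t ht => mem_Ici.2 (add_nonneg hs ht)) (N := s)
    fun t ht => ?_
  rw [h.1 _ (mem_Ici.2 (add_nonneg hs ht)) _ ht]
  simp [abs_of_nonneg hs]

theorem GeodesicLine.Joins.isRayTo_right {α : GeodesicLine X} {a c : VisualBoundary X}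
    (h : α.Joins a c) (s : ℝ) : IsRayTo (fun t => α (s + t)) c := by
  rw [← h.2]
  refine α.forward.isRayTo.of_bounded (α.geodOn.comp_add s fun _ _ => mem_univ _) (N := |s|)
    fun t ht => ?_
  change dist _ (α (t.toNNReal : ℝ)) ≤ _
  rw [Real.coe_toNNReal _ ht, α.geodOn _ (mem_univ _) _ (mem_univ _)]
  simp

theorem GeodesicLine.Joins.isRayTo_left {α : GeodesicLine X} {a c : VisualBoundary X}
    (h : α.Joins a c) (s : ℝ) : IsRayTo (fun t => α (s - t)) a := by
  rw [← h.1]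
  refine α.backward.isRayTo.of_bounded (α.geodOn.comp_sub s fun _ _ => mem_univ _) (N := |s|)
    fun t ht => ?_
  change dist _ (α (-(t.toNNReal : ℝ))) ≤ _
  rw [Real.coe_toNNReal _ ht, α.geodOn _ (mem_univ _) _ (mem_univ _)]
  simp

theorem exists_joins_of_isRayTo {γ : ℝ → X} (hγ : GeodOn γ univ) {a c : VisualBoundary X}
    (ha : IsRayTo (fun t => γ (-t)) a) (hc : IsRayTo γ c) :
    ∃ α : GeodesicLine X, α.Joins a c ∧ ∀ t, α t = γ t := by
  let α : GeodesicLine X := ⟨γ, Isometry.of_dist_eq fun s t => hγ s trivial t trivial⟩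
  exact ⟨α, ⟨ha.endpoint_toRay, hc.endpoint_toRay⟩, fun _ => rfl⟩

/-- The line traversed in the opposite direction. -/
def GeodesicLine.reverse (α : GeodesicLine X) : GeodesicLine X where
  toFun t := α (-t)
  isometry := Isometry.of_dist_eq fun s t => by rw [α.isometry.dist_eq, dist_neg_neg]

theorem GeodesicLine.reverse_apply (α : GeodesicLine X) (t : ℝ) : α.reverse t = α (-t) := rfl

theorem GeodesicLine.range_reverse (α : GeodesicLine X) : range α.reverse = range α := by
  ext x
  constructor
  · rintro ⟨t, rfl⟩; exact ⟨-t, rfl⟩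
  · rintro ⟨t, rfl⟩; exact ⟨-t, by rw [α.reverse_apply, neg_neg]⟩

theorem GeodesicLine.Joins.reverse {α : GeodesicLine X} {a c : VisualBoundary X}
    (h : α.Joins a c) : α.reverse.Joins c a := by
  refine ⟨?_, h.1⟩
  rw [← h.2, GeodesicLine.backward, GeodesicLine.forward]
  congr 2
  funext t
  rw [α.reverse_apply, neg_neg]

/-- In a proper space, geodesics `σ n` that stay bounded at every parameter have a pointwise limit
along an ultrafilter. -/
theorem exists_ultralimit [ProperSpace X] {σ : ℕ → ℝ → X} {o : X} (R : ℝ → ℝ)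
    (h : ∀ t, ∀ᶠ n in atTop, dist (σ n t) o ≤ R t) :
    ∃ (U : Ultrafilter ℕ) (γ : ℝ → X), (U : Filter ℕ) ≤ atTop ∧
      ∀ t, Tendsto (fun n => σ n t) U (𝓝 (γ t)) := by
  obtain ⟨U, hU⟩ := Ultrafilter.exists_le (atTop : Filter ℕ)
  have : ∀ t, ∃ x, Tendsto (fun n => σ n t) U (𝓝 x) := by
    intro t
    obtain ⟨x, _, hx⟩ := (isCompact_closedBall o (R t)).ultrafilter_le_nhds
      (U.map fun n => σ n t) (by
        rw [le_principal_iff, Ultrafilter.coe_map, Filter.mem_map]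
        exact hU (h t))
    exact ⟨x, hx⟩
  choose γ hγ using this
  exact ⟨U, γ, hU, hγ⟩

theorem geodOn_of_tendsto {σ : ℕ → ℝ → X} {U : Ultrafilter ℕ} {γ : ℝ → X} {I : Set ℝ}
    (hU : (U : Filter ℕ) ≤ atTop) (hγ : ∀ t, Tendsto (fun n => σ n t) U (𝓝 (γ t)))
    (h : ∀ s ∈ I, ∀ t ∈ I, ∀ᶠ n in atTop, dist (σ n s) (σ n t) = |s - t|) : GeodOn γ I := by
  intro s hs t ht
  refine tendsto_nhds_unique ((hγ s).dist (hγ t)) ?_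
  refine tendsto_const_nhds.congr' ?_
  filter_upwards [hU (h s hs t ht)] with n hn using hn.symm

theorem dist_le_of_tendsto {σ : ℕ → ℝ → X} {U : Ultrafilter ℕ} {γ : ℝ → X}
    (hU : (U : Filter ℕ) ≤ atTop) (hγ : ∀ t, Tendsto (fun n => σ n t) U (𝓝 (γ t))) {t N : ℝ}
    {x : X} (h : ∀ᶠ n in atTop, dist (σ n t) x ≤ N) : dist (γ t) x ≤ N :=
  le_of_tendsto ((hγ t).dist tendsto_const_nhds) (hU h)

theorem exists_nearest_line [ProperSpace X] (α : GeodesicLine X) (x : X) :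
    ∃ s, IsNearestPoint (range α) x (α s) := by
  obtain ⟨p, hp⟩ := exists_isNearestPoint α.isClosed_range ⟨_, 0, rfl⟩ x
  obtain ⟨s, rfl⟩ := hp.1
  exact ⟨s, hp⟩

variable [CAT0Space X]

/-- By convexity, asymptotic rays are closest at their origins. -/
theorem IsRayTo.dist_le {γ δ : ℝ → X} {ξ : VisualBoundary X} (h : IsRayTo γ ξ)
    (h' : IsRayTo δ ξ) {t : ℝ} (ht : 0 ≤ t) : dist (γ t) (δ t) ≤ dist (γ 0) (δ 0) := by
  obtain ⟨N, hN⟩ := h.bounded h'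
  refine le_of_forall_pos_le_add fun ε hε => ?_
  have hN0 : 0 ≤ N := dist_nonneg.trans (hN 0 le_rfl)
  set T := max t (t * N / ε) + 1 with hT
  have hTt : t ≤ T := by linarith [le_max_left t (t * N / ε)]
  have hTN : t * N / ε ≤ T := by linarith [le_max_right t (t * N / ε)]
  have hT0 : 0 < T := by linarith [le_max_left t (t * N / ε)]
  have key := dist_geod_geod_le h.1 h'.1 (mem_Ici.2 le_rfl) (mem_Ici.2 hT0.le) (mem_Ici.2 le_rfl)
    (mem_Ici.2 hT0.le) (l := t / T) (by positivity) (by rwa [div_le_one hT0])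
  have e : 0 + t / T * (T - 0) = t := by field_simp; simp
  rw [e] at key
  have h1 : t / T * dist (γ T) (δ T) ≤ ε := by
    calc t / T * dist (γ T) (δ T) ≤ t / T * N := by gcongr; exact hN T hT0.le
      _ = t * N / T := by ring
      _ ≤ ε := by
        rw [div_le_iff₀ hT0]; rw [div_le_iff₀ hε] at hTN; linarith
  have h2 : 0 ≤ t / T := by positivity
  nlinarith [dist_nonneg (x := γ 0) (y := δ 0)]

variable [ProperSpace X]

theorem exists_isRayTo (o : X) (ξ : VisualBoundary X) : ∃ γ : ℝ → X, γ 0 = o ∧ IsRayTo γ ξ := by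
  obtain ⟨β, rfl⟩ : ∃ β : GeodesicRay X, β.endpoint = ξ := Quotient.exists_rep ξ
  choose σ h0 h1 hσ using fun n : ℕ => CAT0Space.geodesic o (β.real n)
  set L := fun n : ℕ => dist o (β.real n)
  have hL : ∀ t : ℝ, ∀ᶠ n in atTop, t ≤ L n := by
    intro t
    filter_upwards [tendsto_natCast_atTop_atTop.eventually_ge_atTop (t + dist o (β.real 0))]
      with n hn
    have e := β.geodOn 0 (mem_Ici.2 le_rfl) n (mem_Ici.2 n.cast_nonneg)
    rw [zero_sub, abs_neg, abs_of_nonneg n.cast_nonneg] at e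
    have := dist_triangle (β.real 0) o (β.real n)
    rw [dist_comm _ o] at this
    linarith
  have close : ∀ t : ℝ, 0 ≤ t → ∀ᶠ n in atTop,
      dist (σ n t) (β.real t) ≤ 2 * dist o (β.real 0) := by
    intro t ht
    filter_upwards [hL t] with n hn
    have := dist_le_two_mul_of_common_end (hσ n) β.geodOn n.cast_nonneg (h1 n) ht hn
    rwa [h0 n] at this
  obtain ⟨U, γ, hU, hγ⟩ := exists_ultralimit (σ := fun n t => σ n (max t 0)) (o := o)
    (fun t => max t 0) (by
      intro t
      filter_upwards [hL (max t 0)] with n hn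
      have e := hσ n (max t 0) ⟨le_max_right _ _, hn⟩ 0 ⟨le_rfl, dist_nonneg⟩
      rw [h0 n, sub_zero, abs_of_nonneg (le_max_right _ _)] at e
      exact e.le)
  refine ⟨γ, ?_, ?_, β, rfl, 2 * dist o (β.real 0), ?_⟩
  · exact dist_le_zero.1 (dist_le_of_tendsto hU hγ (Eventually.of_forall fun n => by simp [h0]))
  · refine geodOn_of_tendsto hU hγ fun s hs t ht => ?_
    filter_upwards [hL s, hL t] with n hns hnt
    rw [max_eq_left hs, max_eq_left ht]
    exact hσ n _ ⟨hs, hns⟩ _ ⟨ht, hnt⟩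
  · intro t ht
    refine dist_le_of_tendsto hU hγ ?_
    filter_upwards [close t ht] with n hn
    rwa [max_eq_left ht]

/-- The ray from `o` to the boundary point `ξ`; it is unique, and its values at negative
parameters are irrelevant. -/
noncomputable def ray (o : X) (ξ : VisualBoundary X) : ℝ → X := (exists_isRayTo o ξ).choose

theorem ray_zero (o : X) (ξ : VisualBoundary X) : ray o ξ 0 = o :=
  (exists_isRayTo o ξ).choose_spec.1

theorem isRayTo_ray (o : X) (ξ : VisualBoundary X) : IsRayTo (ray o ξ) ξ :=
  (exists_isRayTo o ξ).choose_spec.2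

theorem ray_geodOn (o : X) (ξ : VisualBoundary X) : GeodOn (ray o ξ) (Ici 0) :=
  (isRayTo_ray o ξ).1

theorem dist_ray_ray (o o' : X) (ξ : VisualBoundary X) {t : ℝ} (ht : 0 ≤ t) :
    dist (ray o ξ t) (ray o' ξ t) ≤ dist o o' := by
  have := (isRayTo_ray o ξ).dist_le (isRayTo_ray o' ξ) ht
  rwa [ray_zero, ray_zero] at this

theorem dist_ray (o : X) (ξ : VisualBoundary X) {s t : ℝ} (hs : 0 ≤ s) (ht : 0 ≤ t) :
    dist (ray o ξ s) (ray o ξ t) = |s - t| := ray_geodOn o ξ s hs t ht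

theorem dist_origin_ray (o : X) (ξ : VisualBoundary X) {t : ℝ} (ht : 0 ≤ t) :
    dist o (ray o ξ t) = t := by
  have := dist_ray o ξ le_rfl ht
  rwa [ray_zero, zero_sub, abs_neg, abs_of_nonneg ht] at this

theorem IsRayTo.eq_ray {γ : ℝ → X} {ξ : VisualBoundary X} (h : IsRayTo γ ξ) {t : ℝ}
    (ht : 0 ≤ t) : γ t = ray (γ 0) ξ t := by
  have := h.dist_le (isRayTo_ray (γ 0) ξ) ht
  rw [ray_zero, dist_self] at this
  exact dist_le_zero.1 this

theorem IsRayTo.image_eq {γ : ℝ → X} {ξ : VisualBoundary X} (h : IsRayTo γ ξ) :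
    γ '' Ici 0 = ray (γ 0) ξ '' Ici 0 := image_congr fun _ ht => h.eq_ray ht

theorem ray_add (o : X) (ξ : VisualBoundary X) {s t : ℝ} (hs : 0 ≤ s) (ht : 0 ≤ t) :
    ray o ξ (s + t) = ray (ray o ξ s) ξ t := by
  have := ((isRayTo_ray o ξ).comp_add hs).eq_ray ht
  rwa [add_zero] at this

theorem GeodesicLine.Joins.apply_add {α : GeodesicLine X} {a c : VisualBoundary X}
    (h : α.Joins a c) (s : ℝ) {t : ℝ} (ht : 0 ≤ t) : α (s + t) = ray (α s) c t := by
  have := (h.isRayTo_right s).eq_ray ht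
  rwa [add_zero] at this

theorem GeodesicLine.Joins.apply_sub {α : GeodesicLine X} {a c : VisualBoundary X}
    (h : α.Joins a c) (s : ℝ) {t : ℝ} (ht : 0 ≤ t) : α (s - t) = ray (α s) a t := by
  have := (h.isRayTo_left s).eq_ray ht
  rwa [sub_zero] at this

theorem eq_of_dist_ray_le {o o' : X} {ξ ξ' : VisualBoundary X} {N : ℝ}
    (h : ∀ t, 0 ≤ t → dist (ray o ξ t) (ray o' ξ' t) ≤ N) : ξ = ξ' :=
  ((isRayTo_ray o' ξ').of_bounded (ray_geodOn o ξ) h).unique (isRayTo_ray o ξ) |>.symm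

/-! ### Rays with a projection gap -/

/-- The ray from `o` to `ξ` satisfies the projection gap inequality with constant `C`. -/
def RayGap (C : ℝ) (o : X) (ξ : VisualBoundary X) : Prop := ProjGap C (ray o ξ '' Ici 0)

theorem RayGap.mono {C C' : ℝ} {o : X} {ξ : VisualBoundary X} (h : RayGap C o ξ) (hC : C ≤ C') :
    RayGap C' o ξ := ProjGap.mono h hC

theorem isClosed_image_ray (o : X) (ξ : VisualBoundary X) : IsClosed (ray o ξ '' Ici 0) :=
  (ray_geodOn o ξ).isClosed_image isClosed_Ici

theorem RayGap.move {C K : ℝ} {o o' : X} {ξ : VisualBoundary X} (h : RayGap C o ξ)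
    (hK : dist o o' ≤ K) : RayGap (3 * C + 8 * K) o' ξ := by
  refine ProjGap.of_close h (isClosed_image_ray o ξ) ?_ ?_
  · rintro _ ⟨t, ht, rfl⟩
    exact ⟨_, ⟨t, ht, rfl⟩, (dist_ray_ray o o' ξ ht).trans hK⟩
  · rintro _ ⟨t, ht, rfl⟩
    exact ⟨_, ⟨t, ht, rfl⟩, (dist_ray_ray o o' ξ ht).trans hK⟩

theorem RayGap.tail {C : ℝ} {o : X} {ξ : VisualBoundary X} (h : RayGap C o ξ) {s : ℝ}
    (hs : 0 ≤ s) : RayGap C (ray o ξ s) ξ := by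
  have h1 := ProjGap.ici h (ray_geodOn o ξ) isClosed_Ici (Ici_subset_Ici.2 hs)
  have : ray (ray o ξ s) ξ '' Ici 0 = ray o ξ '' Ici s := by
    ext x
    constructor
    · rintro ⟨t, ht, rfl⟩
      rw [← ray_add o ξ hs ht]
      exact ⟨s + t, by simpa using ht, rfl⟩
    · rintro ⟨t, ht, rfl⟩
      refine ⟨t - s, by simpa using ht, ?_⟩
      rw [← ray_add o ξ hs (by simpa using ht)]; congr 1; ring
  rwa [RayGap, this]

theorem GeodesicLine.Joins.image_ici {α : GeodesicLine X} {a c : VisualBoundary X}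
    (h : α.Joins a c) (s : ℝ) : α '' Ici s = ray (α s) c '' Ici 0 := by
  ext x
  constructor
  · rintro ⟨t, ht, rfl⟩
    refine ⟨t - s, by simpa using ht, ?_⟩
    rw [← h.apply_add s (by simpa using ht)]; congr 1; ring
  · rintro ⟨t, ht, rfl⟩
    rw [← h.apply_add s ht]
    exact ⟨s + t, by simpa using ht, rfl⟩

theorem GeodesicLine.Joins.image_iic {α : GeodesicLine X} {a c : VisualBoundary X}
    (h : α.Joins a c) (s : ℝ) : α '' Iic s = ray (α s) a '' Ici 0 := by
  ext x
  constructor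
  · rintro ⟨t, ht, rfl⟩
    refine ⟨s - t, by simpa using ht, ?_⟩
    rw [← h.apply_sub s (by simpa using ht)]; congr 1; ring
  · rintro ⟨t, ht, rfl⟩
    rw [← h.apply_sub s ht]
    exact ⟨s - t, by simpa using ht, rfl⟩

theorem GeodesicLine.Joins.rayGap_right {α : GeodesicLine X} {a c : VisualBoundary X}
    (h : α.Joins a c) {C : ℝ} (hα : ProjGap C (range α)) (s : ℝ) : RayGap C (α s) c := by
  rw [RayGap, ← h.image_ici]
  rw [← image_univ] at hα
  exact hα.ici α.geodOn isClosed_univ (subset_univ _)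

theorem GeodesicLine.Joins.rayGap_left {α : GeodesicLine X} {a c : VisualBoundary X}
    (h : α.Joins a c) {C : ℝ} (hα : ProjGap C (range α)) (s : ℝ) : RayGap C (α s) a := by
  rw [RayGap, ← h.image_iic]
  rw [← image_univ] at hα
  exact hα.iic α.geodOn isClosed_univ (subset_univ _)

theorem GeodesicLine.Joins.projGap {α : GeodesicLine X} {a c : VisualBoundary X}
    (h : α.Joins a c) {C s : ℝ} (ha : RayGap C (α s) a) (hc : RayGap C (α s) c) :
    ProjGap (2 * C) (range α) := by
  rw [← image_univ]
  rw [RayGap, ← h.image_ici] at hc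
  rw [RayGap, ← h.image_iic] at ha
  exact ProjGap.of_halves α.geodOn ha hc

theorem GeodesicLine.projGap_of_isContracting (α : GeodesicLine X) {D : ℝ≥0}
    (h : IsContracting D (range α)) : ProjGap (2 * D + 2) (range α) := by
  rw [← image_univ] at h ⊢
  exact h.projGap α.geodOn isClosed_univ

/-- The points of the Morse boundary are those represented by rays with a projection gap. -/
theorem exists_stratum_iff (x₀ : X) (ξ : VisualBoundary X) :
    (∃ D : ℝ≥0, ξ ∈ stratum x₀ D) ↔ ∃ C : ℝ, RayGap C x₀ ξ := by
  constructor
  · rintro ⟨D, β, rfl, rfl, hβ⟩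
    refine ⟨2 * D + 2, ?_⟩
    have h0 : β.real 0 = β 0 := by simp [GeodesicRay.real]
    rw [RayGap, ← h0, ← β.isRayTo.image_eq]
    rw [← β.image_real] at hβ
    exact hβ.projGap β.geodOn isClosed_Ici
  · rintro ⟨C, hC⟩
    refine ⟨2 * C.toNNReal, (ray_geodOn x₀ ξ).toRay, ?_, (isRayTo_ray x₀ ξ).endpoint_toRay, ?_⟩
    · rw [GeodOn.toRay_apply, NNReal.coe_zero, ray_zero]
    · rw [GeodOn.range_toRay]
      refine ProjGap.isContracting (ProjGap.mono hC ?_) (isClosed_image_ray x₀ ξ)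
      exact Real.le_coe_toNNReal C

theorem MorseBoundary.exists_rayGap {x₀ : X} (a : MorseBoundary X x₀) (o : X) :
    ∃ C : ℝ, RayGap C o a.toVisual := by
  obtain ⟨C, hC⟩ := (exists_stratum_iff x₀ _).1 a.2
  exact ⟨_, hC.move le_rfl⟩

end Rays

/-! ### Boundary points that diverge at a point -/

section Apart

variable {X : Type*} [MetricSpace X] [CAT0Space X] [ProperSpace X]

/-- Seen from `o`, the boundary points `a` and `b` are represented by rays with a projection gap,
and their Gromov product at `o` is at most `C`. -/
structure Apart (C : ℝ) (o : X) (a b : VisualBoundary X) : Prop where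
  one_le : 1 ≤ C
  left : RayGap C o a
  right : RayGap C o b
  div : ∀ s t, 0 ≤ s → 0 ≤ t → s + t ≤ dist (ray o a s) (ray o b t) + 2 * C

theorem Apart.symm {C : ℝ} {o : X} {a b : VisualBoundary X} (h : Apart C o a b) :
    Apart C o b a :=
  ⟨h.one_le, h.right, h.left, fun s t hs ht => by
    rw [dist_comm, add_comm s t]; exact h.div t s ht hs⟩

theorem Apart.mono {C C' : ℝ} {o : X} {a b : VisualBoundary X} (h : Apart C o a b)
    (hC : C ≤ C') : Apart C' o a b :=
  ⟨h.one_le.trans hC, h.left.mono hC, h.right.mono hC, fun s t hs ht =>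
    (h.div s t hs ht).trans (by linarith)⟩

theorem Apart.move {C K : ℝ} {o o' : X} {a b : VisualBoundary X} (h : Apart C o a b)
    (hK : dist o o' ≤ K) : Apart (3 * C + 8 * K) o' a b := by
  have hK0 : 0 ≤ K := dist_nonneg.trans hK
  have h1 := h.one_le
  refine ⟨by linarith, h.left.move hK, h.right.move hK, fun s t hs ht => ?_⟩
  have e1 := dist_ray_ray o o' a hs
  have e2 := dist_ray_ray o' o b ht
  rw [dist_comm o' o] at e2
  have := h.div s t hs ht
  have := dist_triangle4 (ray o a s) (ray o' a s) (ray o' b t) (ray o b t)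
  linarith

theorem Apart.ne {C : ℝ} {o : X} {a b : VisualBoundary X} (h : Apart C o a b) : a ≠ b := by
  rintro rfl
  have h1 := h.one_le
  have := h.div (C + 1) (C + 1) (by linarith) (by linarith)
  rw [dist_self] at this
  linarith

theorem exists_nearest_ray (o : X) (a : VisualBoundary X) (x : X) :
    ∃ s, 0 ≤ s ∧ IsNearestPoint (ray o a '' Ici 0) x (ray o a s) := by
  obtain ⟨p, hp⟩ := exists_isNearestPoint (isClosed_image_ray o a) ⟨_, 0, mem_Ici.2 le_rfl, rfl⟩ x
  obtain ⟨s, hs, rfl⟩ := hp.1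
  exact ⟨s, hs, hp⟩

/-- The ray to `b` projects to the initial segment of length `3 / 2 * C` of the ray to `a`. -/
theorem Apart.nearest_le {C : ℝ} {o : X} {a b : VisualBoundary X} (h : Apart C o a b) {s t : ℝ}
    (hs : 0 ≤ s) (ht : 0 ≤ t) (hn : IsNearestPoint (ray o a '' Ici 0) (ray o b t) (ray o a s)) :
    2 * s ≤ 3 * C := by
  have h1 := ProjGap.dist_add_le h.left hn (mem_image_of_mem _ (mem_Ici.2 (le_refl (0 : ℝ))))
  rw [ray_zero, dist_comm _ o, dist_comm _ o, dist_origin_ray o a hs, dist_origin_ray o b ht] at h1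
  have h2 := h.div s t hs ht
  rw [dist_comm] at h2
  linarith

/-- Every line between boundary points that diverge at `o` passes close to `o`: its far ends
project to the ray `[o, a)` at a far point and close to `o`, respectively. -/
theorem Apart.exists_dist_line_le {C : ℝ} {o : X} {a b : VisualBoundary X} (h : Apart C o a b)
    {α : GeodesicLine X} (hα : α.Joins a b) : ∃ t, dist o (α t) ≤ 5 * C := by
  have hC := h.one_le
  set N := dist (α 0) o with hN
  have hN0 : 0 ≤ N := dist_nonneg
  set t := N + 5 * C + 1 with ht
  have ht0 : 0 ≤ t := by linarith
  have hx : dist (α (-t)) (ray o a t) ≤ N := by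
    have := hα.apply_sub 0 ht0
    rw [zero_sub] at this
    rw [this]; exact dist_ray_ray _ _ _ ht0
  have hy : dist (α t) (ray o b t) ≤ N := by
    have := hα.apply_add 0 ht0
    rw [zero_add] at this
    rw [this]; exact dist_ray_ray _ _ _ ht0
  obtain ⟨r, hr0, hr⟩ := exists_nearest_ray o a (ray o b t)
  obtain ⟨r', hr0', hr'⟩ := exists_nearest_ray o a (α t)
  obtain ⟨m, hm0, hm⟩ := exists_nearest_ray o a (α (-t))
  have e1 := h.nearest_le hr0 ht0 hr
  have e2 := h.div r t hr0 ht0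
  have e3 := ProjGap.dist_nearest_le h.left hr hr' (by
    rw [dist_comm (ray o b t) (ray o a r), dist_comm]; linarith)
  rw [dist_ray o a hr0 hr0', abs_le] at e3
  have e4 := (ray_geodOn o a).dist_nearest_le hm
    (isNearestPoint_self (mem_image_of_mem _ (mem_Ici.2 ht0)))
  rw [dist_ray o a hm0 ht0] at e4
  have e5 := abs_le.1 (e4.trans hx)
  obtain ⟨v, -, hv⟩ := ProjGap.exists_dist_le h.left (ray_geodOn o a) isClosed_Ici
    (σ := α) (a := -t) (b := t) (t := 4 * C) (by linarith) (α.geodOn.mono (subset_univ _)) hm0 hr0'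
    hm hr' (mem_uIcc.2 (Or.inr ⟨by linarith, by linarith⟩))
    (lt_abs.2 (Or.inl (by linarith))) (lt_abs.2 (Or.inl (by linarith)))
  refine ⟨v, ?_⟩
  have := dist_triangle o (ray o a (4 * C)) (α v)
  rw [dist_origin_ray o a (by linarith), dist_comm (ray o a _) (α v)] at this
  linarith

theorem Apart.projGap_line {C : ℝ} {o : X} {a b : VisualBoundary X} (h : Apart C o a b)
    {α : GeodesicLine X} (hα : α.Joins a b) : ProjGap (86 * C) (range α) := by
  obtain ⟨t, ht⟩ := h.exists_dist_line_le hα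
  have := hα.projGap (h.left.move ht) (h.right.move ht)
  convert this using 1; ring

/-- The ends of a line with a projection gap diverge at every point close to the line. -/
theorem GeodesicLine.Joins.apart {α : GeodesicLine X} {a b : VisualBoundary X}
    (hα : α.Joins a b) {C K t : ℝ} {o : X} (hC : 1 ≤ C) (h : ProjGap C (range α))
    (ht : dist (α t) o ≤ K) : Apart (3 * C + 8 * K) o a b := by
  refine Apart.move ⟨hC, hα.rayGap_left h t, hα.rayGap_right h t, fun s u hs hu => ?_⟩ ht
  rw [← hα.apply_sub t hs, ← hα.apply_add t hu, α.dist_eq, abs_of_nonpos (by linarith)]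
  linarith

/-- The segments between points far along the two rays pass close to `o`; a limit of them is a line
from `a` to `b`. -/
theorem Apart.exists_joins {C : ℝ} {o : X} {a b : VisualBoundary X} (h : Apart C o a b) :
    ∃ α : GeodesicLine X, α.Joins a b := by
  have hC := h.one_le
  choose σ h0 h1 hσ using fun n : ℕ => CAT0Space.geodesic (ray o a n) (ray o b n)
  set L := fun n : ℕ => dist (ray o a n) (ray o b n)
  have hv : ∀ n : ℕ, ∃ v, 4 * C + 1 ≤ n → v ∈ Icc 0 (L n) ∧ dist (σ n v) o ≤ 4 * C := by
    intro n
    by_cases hn : 4 * C + 1 ≤ n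
    · have hn0 : (0 : ℝ) ≤ n := n.cast_nonneg
      obtain ⟨r, hr0, hr⟩ := exists_nearest_ray o a (ray o b n)
      have e1 := h.nearest_le hr0 hn0 hr
      obtain ⟨v, hv, hd⟩ := ProjGap.exists_dist_le h.left (ray_geodOn o a) isClosed_Ici
        (σ := σ n) (a := 0) (b := L n) (s := n) (t := 3 * C) dist_nonneg (hσ n) hn0 hr0
        (by rw [h0]; exact isNearestPoint_self (mem_image_of_mem _ (mem_Ici.2 hn0)))
        (by rw [h1]; exact hr) (mem_uIcc.2 (Or.inr ⟨by linarith, by linarith⟩))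
        (lt_abs.2 (Or.inl (by linarith))) (lt_abs.2 (Or.inl (by linarith)))
      refine ⟨v, fun _ => ⟨hv, ?_⟩⟩
      have := dist_triangle (σ n v) (ray o a (3 * C)) o
      rw [dist_comm _ o, dist_comm _ o, dist_origin_ray o a (by linarith)] at this
      rw [dist_comm]
      linarith
    · exact ⟨0, fun h => absurd h hn⟩
  choose v hv using hv
  have hbig : ∀ R : ℝ, ∀ᶠ n : ℕ in atTop, R ≤ n := fun R =>
    tendsto_natCast_atTop_atTop.eventually_ge_atTop R
  -- `σ n` passes close to `o` at the parameter `v n`; both ends are far away from there.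
  have hvn : ∀ R : ℝ, ∀ᶠ n in atTop, R ≤ v n ∧ v n + R ≤ L n := by
    intro R
    filter_upwards [hbig (4 * C + 1), hbig (R + 4 * C)] with n hn hn'
    obtain ⟨hvI, hvd⟩ := hv n hn
    have e1 := hσ n 0 ⟨le_rfl, dist_nonneg⟩ _ hvI
    have e2 := hσ n _ hvI (L n) ⟨dist_nonneg, le_rfl⟩
    rw [h0, zero_sub, abs_neg, abs_of_nonneg hvI.1] at e1
    rw [h1, abs_of_nonpos (by linarith [hvI.2])] at e2
    have e3 := dist_origin_ray o a (n.cast_nonneg (α := ℝ))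
    have e4 := dist_origin_ray o b (n.cast_nonneg (α := ℝ))
    have t1 := dist_triangle o (σ n (v n)) (ray o a n)
    have t2 := dist_triangle o (σ n (v n)) (ray o b n)
    rw [dist_comm o (σ n _)] at t1 t2
    rw [dist_comm] at e1
    constructor <;> linarith
  have right : ∀ t, 0 ≤ t → ∀ᶠ n in atTop, dist (σ n (v n + t)) (ray o b t) ≤ 8 * C := by
    intro t ht
    filter_upwards [hbig (4 * C + 1), hvn t] with n hn hn'
    obtain ⟨hvI, hvd⟩ := hv n hn
    have g : GeodOn (fun t => σ n (v n + t)) (Icc 0 (L n - v n)) :=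
      GeodOn.comp_add (hσ n) _ fun t ht => ⟨by linarith [hvI.1, ht.1], by linarith [ht.2]⟩
    have := dist_le_two_mul_of_common_end g (ray_geodOn o b) (n.cast_nonneg)
      (by rw [← h1]; congr 1; ring) ht (by linarith)
    simp only [add_zero, ray_zero] at this
    linarith
  have left : ∀ t, 0 ≤ t → ∀ᶠ n in atTop, dist (σ n (v n - t)) (ray o a t) ≤ 8 * C := by
    intro t ht
    filter_upwards [hbig (4 * C + 1), hvn t] with n hn hn'
    obtain ⟨hvI, hvd⟩ := hv n hn
    have g : GeodOn (fun t => σ n (v n - t)) (Icc 0 (v n)) :=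
      GeodOn.comp_sub (hσ n) _ fun t ht => ⟨by linarith [ht.2], by linarith [ht.1, hvI.2]⟩
    have := dist_le_two_mul_of_common_end g (ray_geodOn o a) (n.cast_nonneg)
      (by rw [← h0, sub_self]) ht (by linarith)
    simp only [sub_zero, ray_zero] at this
    linarith
  obtain ⟨U, γ, hU, hγ⟩ := exists_ultralimit (σ := fun n t => σ n (v n + t)) (o := o)
    (fun t => 8 * C + |t|) (by
      intro t
      rcases le_total 0 t with ht | ht
      · filter_upwards [right t ht] with n hn
        have := dist_triangle (σ n (v n + t)) (ray o b t) o
        rw [dist_comm _ o, dist_comm _ o, dist_origin_ray o b ht] at this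
        rw [abs_of_nonneg ht, dist_comm]
        linarith
      · filter_upwards [left (-t) (by linarith)] with n hn
        have := dist_triangle (σ n (v n + t)) (ray o a (-t)) o
        rw [dist_comm _ o, dist_comm _ o, dist_origin_ray o a (by linarith)] at this
        rw [abs_of_nonpos ht, dist_comm]
        rw [sub_neg_eq_add] at hn
        linarith)
  have hgeod : GeodOn γ univ := by
    refine geodOn_of_tendsto hU hγ fun s _ t _ => ?_
    filter_upwards [hbig (4 * C + 1), hvn |s|, hvn |t|] with n hn hs ht
    have := le_abs_self s
    have := neg_abs_le s
    have := le_abs_self t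
    have := neg_abs_le t
    rw [hσ n _ ⟨by linarith, by linarith⟩ _ ⟨by linarith, by linarith⟩]
    congr 1; ring
  obtain ⟨α, hα, -⟩ := exists_joins_of_isRayTo hgeod (a := a) (c := b)
    ((isRayTo_ray o a).of_bounded
      (fun s _ t _ => by rw [hgeod _ trivial _ trivial, ← abs_neg]; congr 1; ring) fun t ht =>
        dist_le_of_tendsto hU hγ (left t ht))
    ((isRayTo_ray o b).of_bounded (hgeod.mono (subset_univ _)) fun t ht =>
      dist_le_of_tendsto hU hγ (right t ht))
  exact ⟨α, hα⟩

/-- Two different rays with a projection gap diverge at some point, with a uniform constant: the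
point where the projection of the second ray to the first one stops, up to a bounded amount. -/
theorem RayGap.exists_apart {C : ℝ} {o : X} {a b : VisualBoundary X} (hC : 1 ≤ C)
    (ha : RayGap C o a) (hb : RayGap C o b) (hab : a ≠ b) : ∃ o', Apart (11 * C) o' a b := by
  choose p hp0 hp using fun t => exists_nearest_ray o a (ray o b t)
  have hp00 : p 0 = 0 := by
    have h1 := (hp 0).dist_le (mem_image_of_mem _ (mem_Ici.2 (le_refl (0 : ℝ))))
    rw [ray_zero, ray_zero, dist_self, dist_origin_ray o a (hp0 0)] at h1
    linarith [hp0 0]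
  -- A point of the first ray before the projection of some `ray o b t` is close to `ray o b`.
  have pass : ∀ R t, C < R → 0 ≤ t → R + C < p t →
      ∃ v, 0 ≤ v ∧ dist (ray o b v) (ray o a R) ≤ C ∧ |v - R| ≤ C := by
    intro R t hR ht hRt
    obtain ⟨v, hv, hd⟩ := ProjGap.exists_dist_le ha (ray_geodOn o a) isClosed_Ici
      (σ := ray o b) (a := 0) (b := t) (s := 0) (t := R) ht
      ((ray_geodOn o b).mono Icc_subset_Ici_self) (mem_Ici.2 le_rfl) (hp0 t)
      (by simpa [hp00] using hp 0) (hp t) (mem_uIcc.2 (Or.inl ⟨by linarith, by linarith⟩))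
      (lt_abs.2 (Or.inr (by linarith))) (lt_abs.2 (Or.inr (by linarith)))
    refine ⟨v, hv.1, hd, ?_⟩
    have e1 := dist_origin_ray o b hv.1
    have e2 := dist_origin_ray o a (show 0 ≤ R by linarith)
    have t1 := dist_triangle o (ray o a R) (ray o b v)
    have t2 := dist_triangle o (ray o b v) (ray o a R)
    rw [dist_comm (ray o a R)] at t1
    rw [abs_le]; constructor <;> linarith
  have key : ∀ s t, 0 ≤ s → 0 ≤ t → s + t - 2 * p t ≤ dist (ray o a s) (ray o b t) + C := by
    intro s t hs ht
    have h1 := ProjGap.dist_add_le ha (hp t) (mem_image_of_mem _ (mem_Ici.2 hs))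
    rw [dist_ray o a (hp0 t) hs] at h1
    have t1 := dist_triangle o (ray o a (p t)) (ray o b t)
    rw [dist_origin_ray o a (hp0 t), dist_origin_ray o b ht, dist_comm (ray o a _)] at t1
    rw [dist_comm]
    linarith [neg_abs_le (p t - s)]
  by_cases hbdd : ∃ B, ∀ t, 0 ≤ t → p t ≤ B
  · obtain ⟨B, hB⟩ := hbdd
    obtain ⟨t₀, ht₀, hmax⟩ : ∃ t₀, 0 ≤ t₀ ∧ ∀ t, 0 ≤ t → p t ≤ p t₀ + 1 := by
      have hne : (p '' Ici 0).Nonempty := ⟨_, 0, mem_Ici.2 le_rfl, rfl⟩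
      have hbd : BddAbove (p '' Ici 0) := ⟨B, by rintro _ ⟨t, ht, rfl⟩; exact hB t ht⟩
      obtain ⟨_, ⟨t₀, ht₀, rfl⟩, hlt⟩ := exists_lt_of_lt_csSup hne
        (show sSup (p '' Ici 0) - 1 < sSup (p '' Ici 0) by linarith)
      refine ⟨t₀, ht₀, fun t ht => ?_⟩
      linarith [le_csSup hbd (mem_image_of_mem p (mem_Ici.2 ht))]
    rcases le_or_gt (p t₀) (3 * C + 1) with hT | hT
    · refine ⟨o, by linarith, ha.mono (by linarith), hb.mono (by linarith), fun s t hs ht => ?_⟩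
      linarith [key s t hs ht, hmax t ht]
    · obtain ⟨v, hv0, hvd, hvR⟩ := pass (p t₀ - 2 * C) t₀ (by linarith) ht₀ (by linarith)
      set R := p t₀ - 2 * C with hR
      have hR0 : 0 ≤ R := by linarith
      rw [abs_le] at hvR
      refine ⟨ray o a R, by linarith, (ha.tail hR0).mono (by linarith),
        ((hb.tail hv0).move hvd).mono (by linarith), fun s t hs ht => ?_⟩
      rw [← ray_add o a hR0 hs]
      have e1 := dist_ray_ray _ _ b ht |>.trans hvd
      rw [← ray_add o b hv0 ht] at e1
      have e2 := key (R + s) (v + t) (by linarith) (by linarith)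
      have e3 := hmax (v + t) (by linarith)
      have t1 := dist_triangle_right (ray o a (R + s)) (ray o b (v + t)) (ray (ray o a R) b t)
      linarith
  · push Not at hbdd
    refine absurd (eq_of_dist_ray_le (o := o) (o' := o) (N := 4 * C) fun R hR => ?_) hab
    rcases le_or_gt R (2 * C) with hRC | hRC
    · have := dist_triangle_left (ray o a R) (ray o b R) o
      rw [dist_origin_ray o a hR, dist_origin_ray o b hR] at this
      linarith
    · obtain ⟨t, ht, hpt⟩ := hbdd (R + C)
      obtain ⟨v, hv0, hvd, hvR⟩ := pass R t (by linarith) ht hpt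
      have := dist_triangle (ray o a R) (ray o b v) (ray o b R)
      rw [dist_ray o b hv0 hR, dist_comm (ray o a R) (ray o b v)] at this
      linarith

/-- Hyperbolicity of Gromov products at `o`: a boundary point `u` cannot be close to both of two
points that diverge at `o`. -/
theorem Apart.exchange {C : ℝ} {o : X} {a b u : VisualBoundary X} (h : Apart C o a b)
    (hu : RayGap C o u) : Apart (4 * C) o a u ∨ Apart (4 * C) o b u := by
  have hC := h.one_le
  by_contra! hcon
  -- If `c` and `u` do not diverge, then the ray to `u` is close to the ray to `c` at time `3 * C`.
  have aux : ∀ c, RayGap C o c → ¬ Apart (4 * C) o c u →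
      ∃ s, 0 ≤ s ∧ dist (ray o c s) (ray o u (3 * C)) ≤ s - 2 * C := by
    intro c hc hcu
    have : ¬ ∀ s t, 0 ≤ s → 0 ≤ t → s + t ≤ dist (ray o c s) (ray o u t) + 2 * (4 * C) :=
      fun hdiv => hcu ⟨by linarith, hc.mono (by linarith), hu.mono (by linarith), hdiv⟩
    push Not at this
    obtain ⟨s, t, hs, ht, hst⟩ := this
    obtain ⟨p, hp0, hp⟩ := exists_nearest_ray o u (ray o c s)
    have h1 := ProjGap.dist_add_le hu hp (mem_image_of_mem _ (mem_Ici.2 (le_refl (0 : ℝ))))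
    rw [ray_zero, dist_comm _ o, dist_comm _ o, dist_origin_ray o u hp0,
      dist_origin_ray o c hs] at h1
    have h2 := ProjGap.dist_add_le hu hp (mem_image_of_mem _ (mem_Ici.2 ht))
    rw [dist_ray o u hp0 ht] at h2
    have t1 := dist_triangle o (ray o u p) (ray o c s)
    rw [dist_origin_ray o u hp0, dist_origin_ray o c hs, dist_comm (ray o u p)] at t1
    have hp3 : 3 * C < p := by linarith [neg_abs_le (p - t)]
    refine ⟨s, hs, ?_⟩
    have t2 := dist_triangle (ray o c s) (ray o u p) (ray o u (3 * C))
    rw [dist_ray o u hp0 (by linarith), abs_of_nonneg (by linarith)] at t2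
    linarith
  obtain ⟨s, hs, h1⟩ := aux a h.left hcon.1
  obtain ⟨t, ht, h2⟩ := aux b h.right hcon.2
  have := h.div s t hs ht
  have := dist_triangle_right (ray o a s) (ray o b t) (ray o u (3 * C))
  linarith

end Apart

/-! ### Centers of ideal triangles and cross-ratios -/

section Tripod

variable {X : Type*} [MetricSpace X] [CAT0Space X] [ProperSpace X]

/-- `o` is a center, with constant `C`, of the ideal triangle with vertices `a`, `b`, `c`. -/
structure Tripod (C : ℝ) (o : X) (a b c : VisualBoundary X) : Prop where
  ab : Apart C o a b
  bc : Apart C o b c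
  ac : Apart C o a c

theorem Tripod.swap {C : ℝ} {o : X} {a b c : VisualBoundary X} (h : Tripod C o a b c) :
    Tripod C o b a c := ⟨h.ab.symm, h.ac, h.bc⟩

theorem Tripod.rotate {C : ℝ} {o : X} {a b c : VisualBoundary X} (h : Tripod C o a b c) :
    Tripod C o b c a := ⟨h.bc, h.ac.symm, h.ab.symm⟩

theorem Tripod.mono {C C' : ℝ} {o : X} {a b c : VisualBoundary X} (h : Tripod C o a b c)
    (hC : C ≤ C') : Tripod C' o a b c := ⟨h.ab.mono hC, h.bc.mono hC, h.ac.mono hC⟩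

theorem Tripod.move {C K : ℝ} {o o' : X} {a b c : VisualBoundary X} (h : Tripod C o a b c)
    (hK : dist o o' ≤ K) : Tripod (3 * C + 8 * K) o' a b c :=
  ⟨h.ab.move hK, h.bc.move hK, h.ac.move hK⟩

theorem Tripod.one_le {C : ℝ} {o : X} {a b c : VisualBoundary X} (h : Tripod C o a b c) :
    1 ≤ C := h.ab.one_le

/-- The points of the ray from a center to `b` project to a line from `a` to `c` near the
center. -/
theorem Tripod.exists_nearest_ray_near {C : ℝ} {o : X} {a b c : VisualBoundary X}
    (h : Tripod C o a b c) {α : GeodesicLine X} (hα : α.Joins a c) :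
    ∃ t₀, dist o (α t₀) ≤ 5 * C ∧ ∀ t, 0 ≤ t → ∀ u,
      IsNearestPoint (range α) (ray o b t) (α u) → |u - t₀| ≤ 49 * C := by
  have hC := h.one_le
  obtain ⟨t₀, ht₀⟩ := h.ac.exists_dist_line_le hα
  have hgap := h.ac.projGap_line hα
  refine ⟨t₀, ht₀, fun t ht u hu => ?_⟩
  have h1 := hgap.dist_add_le hu ⟨t₀, rfl⟩
  rw [α.dist_eq] at h1
  have t1 := dist_triangle_left (ray o b t) (α t₀) o
  rw [dist_origin_ray o b ht] at t1
  have h2 : t + |u - t₀| ≤ dist (ray o b t) (α u) + 7 * C := by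
    rcases le_total t₀ u with hle | hle
    · have hl : 0 ≤ u - t₀ := by linarith
      rw [abs_of_nonneg hl]
      have e := hα.apply_add t₀ hl
      rw [add_sub_cancel] at e
      have := dist_ray_ray o (α t₀) c hl
      rw [← e] at this
      have := h.bc.div t (u - t₀) ht hl
      have := dist_triangle_right (ray o b t) (ray o c (u - t₀)) (α u)
      linarith
    · have hl : 0 ≤ t₀ - u := by linarith
      rw [abs_sub_comm, abs_of_nonneg hl]
      have e := hα.apply_sub t₀ hl
      rw [sub_sub_cancel] at e
      have := dist_ray_ray o (α t₀) a hl
      rw [← e] at this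
      have := h.ab.symm.div t (t₀ - u) ht hl
      have := dist_triangle_right (ray o b t) (ray o a (t₀ - u)) (α u)
      linarith
  linarith

theorem dist_ray_endpoint (β : GeodesicRay X) (o : X) (t : ℝ≥0) :
    dist (ray o β.endpoint t) (β t) ≤ dist o (β 0) := by
  have := (isRayTo_ray o β.endpoint).dist_le β.isRayTo t.coe_nonneg
  rwa [ray_zero, β.real_coe, ← NNReal.coe_zero, β.real_coe] at this

/-- The set `P_α(b)` is nonempty and bounded, so that its infimum and supremum are meaningful: rays
that represent `b` are asymptotic to the ray from the center, and far from `α` they project close to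
it. -/
theorem Tripod.boundaryProjParams_near {C : ℝ} {o : X} {a b c : VisualBoundary X}
    (h : Tripod C o a b c) {α : GeodesicLine X} (hα : α.Joins a c) :
    ∃ t₀, dist o (α t₀) ≤ 5 * C ∧ (boundaryProjParams α b).Nonempty ∧
      boundaryProjParams α b ⊆ Icc (t₀ - 135 * C) (t₀ + 135 * C) := by
  have hC := h.one_le
  obtain ⟨t₀, ht₀, hnear⟩ := h.exists_nearest_ray_near hα
  have hgap := h.ac.projGap_line hα
  refine ⟨t₀, ht₀, ?_, ?_⟩
  · choose u hu using fun n : ℕ => exists_nearest_line α (ray o b n)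
    have hmem : ∀ n, u n ∈ Icc (t₀ - 49 * C) (t₀ + 49 * C) := fun n => by
      have := abs_le.1 (hnear n n.cast_nonneg _ (hu n))
      constructor <;> linarith
    obtain ⟨s, -, φ, hφ, hs⟩ := isCompact_Icc.tendsto_subseq hmem
    refine ⟨s, (ray_geodOn o b).toRay, (isRayTo_ray o b).endpoint_toRay,
      fun n => (φ n : ℝ≥0), u ∘ φ, tendsto_natCast_atTop_atTop.comp hφ.tendsto_atTop,
      fun n => ?_, hs⟩
    rw [GeodOn.toRay_apply]
    simpa using hu (φ n)
  · rintro s ⟨β, rfl, t, u, ht, hn, hu⟩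
    have htr : Tendsto (fun i => (t i : ℝ)) atTop atTop := NNReal.tendsto_coe_atTop.2 ht
    have hev : ∀ᶠ i in atTop, u i ∈ Icc (t₀ - 135 * C) (t₀ + 135 * C) := by
      filter_upwards [htr.eventually_ge_atTop (dist o (β 0) + 54 * C)] with i hi
      obtain ⟨w, hw⟩ := exists_nearest_line α (ray o β.endpoint (t i))
      have e1 := hnear _ (t i).coe_nonneg w hw
      have e2 := dist_ray_endpoint β o (t i)
      have t1 := dist_triangle4 o (α t₀) (α w) (ray o β.endpoint (t i))
      rw [dist_origin_ray o _ (t i).coe_nonneg, α.dist_eq, abs_sub_comm,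
        dist_comm (α w)] at t1
      have e3 := hgap.dist_nearest_le hw (hn i) (by linarith)
      rw [α.dist_eq] at e3
      rw [abs_le] at e1 e3
      constructor <;> linarith
    exact isClosed_Icc.mem_of_tendsto hu hev

/-- The projection of `b` to a line from `a` to `c` is close to every center. -/
theorem Tripod.dist_boundaryProj_le {C : ℝ} {o : X} {a b c : VisualBoundary X}
    (h : Tripod C o a b c) {α : GeodesicLine X} (hα : α.Joins a c) :
    dist o (boundaryProj α b) ≤ 140 * C := by
  obtain ⟨t₀, ht₀, hne, hsub⟩ := h.boundaryProjParams_near hα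
  have b1 := le_csInf hne fun s hs => (hsub hs).1
  have b2 := csSup_le hne fun s hs => (hsub hs).2
  have b3 : sInf (boundaryProjParams α b) ≤ sSup (boundaryProjParams α b) :=
    csInf_le_csSup hne ⟨_, fun s hs => (hsub hs).1⟩ ⟨_, fun s hs => (hsub hs).2⟩
  have t1 := dist_triangle o (α t₀) (boundaryProj α b)
  rw [boundaryProj, α.dist_eq] at t1
  have : |t₀ - (sInf (boundaryProjParams α b) + sSup (boundaryProjParams α b)) / 2| ≤ 135 * C := by
    rw [abs_le]; constructor <;> linarith
  rw [boundaryProj]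
  linarith

theorem Tripod.dist_center_le {C : ℝ} {o o' : X} {a b c : VisualBoundary X}
    (h : Tripod C o a b c) (h' : Tripod C o' a b c) : dist o o' ≤ 280 * C := by
  obtain ⟨α, hα⟩ := h.ac.exists_joins
  have := h.dist_boundaryProj_le hα
  have := h'.dist_boundaryProj_le hα
  have := dist_triangle_right o o' (boundaryProj α b)
  linarith

/-- Two triangles `a, b, c` and `a, d, c` with a common center have a bounded cross-ratio. -/
theorem absCrossRatio_le {x₀ : X} {C : ℝ} {o : X} {a b c d : MorseBoundary X x₀}
    (h : Tripod C o a.toVisual b.toVisual c.toVisual)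
    (h' : Tripod C o a.toVisual d.toVisual c.toVisual) :
    absCrossRatio a b c d ≤ 280 * C := by
  refine Real.iSup_le (fun α => ?_) (by linarith [h.one_le])
  have := h.dist_boundaryProj_le α.2
  have := h'.dist_boundaryProj_le α.2
  have := dist_triangle_left (boundaryProj α.1 b.toVisual) (boundaryProj α.1 d.toVisual) o
  linarith

/-- The cross-ratio controls the distance between the centers of `a, b, c` and `a, d, c`. The
supremum is over a nonempty bounded set here, so it has its intended value. -/
theorem dist_center_le_absCrossRatio {x₀ : X} {C : ℝ} {o o' : X} {a b c d : MorseBoundary X x₀}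
    (h : Tripod C o a.toVisual b.toVisual c.toVisual)
    (h' : Tripod C o' a.toVisual d.toVisual c.toVisual) :
    dist o o' ≤ absCrossRatio a b c d + 280 * C := by
  obtain ⟨α, hα⟩ := h.ac.exists_joins
  have hbdd : BddAbove (range fun α : {α : GeodesicLine X // α.Joins a.toVisual c.toVisual} =>
      dist (boundaryProj α.1 b.toVisual) (boundaryProj α.1 d.toVisual)) := by
    refine ⟨dist o o' + 280 * C, ?_⟩
    rintro _ ⟨α, rfl⟩
    have e1 := h.dist_boundaryProj_le α.2
    have e2 := h'.dist_boundaryProj_le α.2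
    have := dist_triangle4 (boundaryProj α.1 b.toVisual) o o' (boundaryProj α.1 d.toVisual)
    rw [dist_comm _ o] at this
    simp only
    linarith
  have e0 := le_ciSup hbdd ⟨α, hα⟩
  have e1 := h.dist_boundaryProj_le hα
  have e2 := h'.dist_boundaryProj_le hα
  have t1 := dist_triangle4 o (boundaryProj α b.toVisual) (boundaryProj α d.toVisual) o'
  rw [dist_comm (boundaryProj α d.toVisual) o'] at t1
  rw [absCrossRatio]
  simp only at e0
  linarith

/-- The ray to `b` projects to a line `α` from `a` to `c` close to every line from `a` to `b`:
such a line comes from the end `a` of `α` and goes to the end `b`, which projects to a point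
further along `α`. -/
theorem Tripod.exists_line_near {C₀ C : ℝ} {x₀ : X} {a b c : VisualBoundary X}
    (h : Tripod C₀ x₀ a b c) {α l : GeodesicLine X} (hα : α.Joins a c) (hl : l.Joins a b)
    (hC : 0 ≤ C) (hgap : ProjGap C (range α)) :
    ∃ T, ∀ t, T ≤ t → 0 ≤ t → ∀ u, IsNearestPoint (range α) (ray x₀ b t) (α u) →
      ∃ v, dist (l v) (α u) ≤ 3 * C + 1 := by
  have hC₀ := h.one_le
  obtain ⟨t₀, ht₀, hnear⟩ := h.exists_nearest_ray_near hα
  refine ⟨54 * C₀ + dist (l 0) x₀, fun t hT ht u hu => ?_⟩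
  have hut := hnear t ht u hu
  have e1 : dist (ray x₀ b t) (l t) ≤ dist (l 0) x₀ := by
    have := hl.apply_add 0 ht
    rw [zero_add] at this
    rw [this, dist_comm]
    exact dist_ray_ray _ _ _ ht
  have t1 := dist_triangle4 x₀ (α t₀) (α u) (ray x₀ b t)
  rw [dist_origin_ray x₀ b ht, α.dist_eq, abs_sub_comm, dist_comm (α u)] at t1
  obtain ⟨w, hw⟩ := exists_nearest_line α (l t)
  have e2 := hgap.dist_nearest_le hu hw (by linarith)
  rw [α.dist_eq, abs_le] at e2
  -- The end `a` of `l` projects far in the direction of the end `a` of `α`.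
  set N := dist (l 0) (α 0)
  have hN : 0 ≤ N := dist_nonneg
  set s := N + |u| + 4 * C + 2
  have hs : 0 ≤ s := by positivity
  obtain ⟨m, hm⟩ := exists_nearest_line α (l (-s))
  have e3 : dist (l (-s)) (α (-s)) ≤ N := by
    have e := hl.apply_sub 0 hs
    have e' := hα.apply_sub 0 hs
    rw [zero_sub] at e e'
    rw [e, e']
    exact dist_ray_ray _ _ _ hs
  have hgap' := hgap
  rw [← image_univ] at hgap' hm hw
  have e4 := (α.geodOn.dist_nearest_le hm
    (isNearestPoint_self (mem_image_of_mem _ (mem_univ (-s))))).trans e3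
  rw [α.dist_eq, abs_le] at e4
  have hu1 := neg_abs_le u
  obtain ⟨v, -, hv⟩ := ProjGap.exists_dist_le hgap' α.geodOn isClosed_univ
    (σ := l) (a := -s) (b := t) (t := u - 2 * C - 1) (by linarith)
    (l.geodOn.mono (subset_univ _)) (mem_univ m) (mem_univ w)
    hm hw (mem_uIcc.2 (Or.inl ⟨by linarith, by linarith⟩))
    (lt_abs.2 (Or.inr (by linarith))) (lt_abs.2 (Or.inr (by linarith)))
  refine ⟨v, ?_⟩
  have t2 := dist_triangle (l v) (α (u - 2 * C - 1)) (α u)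
  rw [α.dist_eq (u - 2 * C - 1), abs_of_nonpos (by linarith)] at t2
  linarith

/-- Distinct Morse boundary points diverge at every point, with a constant that depends on
them. -/
theorem MorseBoundary.exists_apart {x₀ : X} {a b : MorseBoundary X x₀} (hab : a ≠ b) (o : X) :
    ∃ C, Apart C o a.toVisual b.toVisual := by
  obtain ⟨A, hA⟩ := a.exists_rayGap o
  obtain ⟨B, hB⟩ := b.exists_rayGap o
  obtain ⟨o', ho'⟩ := RayGap.exists_apart (C := max (max A B) 1) (le_max_right _ _)
    (hA.mono (le_max_of_le_left (le_max_left _ _)))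
    (hB.mono (le_max_of_le_left (le_max_right _ _))) fun h => hab (Subtype.ext h)
  exact ⟨_, ho'.move le_rfl⟩

theorem MorseBoundary.exists_tripod {x₀ : X} {a b c : MorseBoundary X x₀} (hab : a ≠ b)
    (hbc : b ≠ c) (hac : a ≠ c) (o : X) :
    ∃ C, Tripod C o a.toVisual b.toVisual c.toVisual := by
  obtain ⟨C₁, h₁⟩ := exists_apart hab o
  obtain ⟨C₂, h₂⟩ := exists_apart hbc o
  obtain ⟨C₃, h₃⟩ := exists_apart hac o
  exact ⟨max (max C₁ C₂) C₃, h₁.mono (le_max_of_le_left (le_max_left _ _)),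
    h₂.mono (le_max_of_le_left (le_max_right _ _)), h₃.mono (le_max_right _ _)⟩

/-- An ideal triangle all of whose sides have a projection gap has a center, with a uniform
constant. -/
theorem MorseBoundary.exists_center {x₀ : X} {a b c : MorseBoundary X x₀} (hab : a ≠ b)
    (hbc : b ≠ c) (hac : a ≠ c) {C : ℝ} (hC : 1 ≤ C)
    (gab : ∀ α : GeodesicLine X, α.Joins a.toVisual b.toVisual → ProjGap C (range α))
    (gbc : ∀ α : GeodesicLine X, α.Joins b.toVisual c.toVisual → ProjGap C (range α))
    (gac : ∀ α : GeodesicLine X, α.Joins a.toVisual c.toVisual → ProjGap C (range α)) :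
    ∃ o, Tripod (35 * C) o a.toVisual b.toVisual c.toVisual := by
  obtain ⟨C₀, h⟩ := exists_tripod hab hbc hac x₀
  obtain ⟨α, hα⟩ := h.ac.exists_joins
  obtain ⟨l, hl⟩ := h.ab.exists_joins
  obtain ⟨m, hm⟩ := h.bc.exists_joins
  obtain ⟨T, hT⟩ := h.exists_line_near hα hl (by linarith) (gac α hα)
  obtain ⟨S, hS⟩ := h.rotate.swap.exists_line_near hα.reverse hm.reverse (by linarith)
    (by rw [α.range_reverse]; exact gac α hα)
  set t := max (max T S) 0
  have ht0 : 0 ≤ t := le_max_right _ _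
  obtain ⟨u, hu⟩ := exists_nearest_line α (ray x₀ b.toVisual t)
  obtain ⟨v, hv⟩ := hT t (le_max_of_le_left (le_max_left _ _)) ht0 u hu
  obtain ⟨w, hw⟩ := hS t (le_max_of_le_left (le_max_right _ _)) ht0 (-u)
    (by rw [α.range_reverse, α.reverse_apply, neg_neg]; exact hu)
  rw [m.reverse_apply, α.reverse_apply, neg_neg] at hw
  have e1 : 3 * C + 8 * (4 * C) = 35 * C := by ring
  refine ⟨α u, ?_, ?_, ?_⟩
  · rw [← e1]; exact hl.apart hC (gab l hl) (hv.trans (by linarith))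
  · rw [← e1]; exact hm.apart hC (gbc m hm) (hw.trans (by linarith))
  · rw [← e1]; exact hα.apart hC (gac α hα) (t := u) (by rw [dist_self]; linarith)

end Tripod

/-! ### Images of ideal triangles under quasi-mobius maps -/

section Maps

variable {X Y : Type*} [MetricSpace X] [CAT0Space X] [ProperSpace X]
  [MetricSpace Y] [CAT0Space Y] [ProperSpace Y] {x₀ : X} {y₀ : Y}

/-- `o` is a center, with constant `C`, of the ideal triangle with the given vertices in the Morse
boundary. -/
abbrev IsCenter (C : ℝ) (o : X) (a b c : MorseBoundary X x₀) : Prop :=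
  Tripod C o a.toVisual b.toVisual c.toVisual

theorem Apart.isContracting_line {C : ℝ} {o : X} {a b : VisualBoundary X} (h : Apart C o a b)
    {α : GeodesicLine X} (hα : α.Joins a b) :
    IsContracting (2 * (86 * C).toNNReal) (range α) :=
  ProjGap.isContracting ((h.projGap_line hα).mono (Real.le_coe_toNNReal _)) α.isClosed_range

/-- Tuples of points that pairwise diverge somewhere, with a common constant, are contracting
tuples; the point of divergence may depend on the pair. -/
theorem mem_contractingTuples {n : ℕ} {C : ℝ} {a : Fin n → MorseBoundary X x₀}
    (h : ∀ i j, i < j → ∃ o, Apart C o (a i).toVisual (a j).toVisual) :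
    a ∈ contractingTuples x₀ n (2 * (86 * C).toNNReal) := by
  have h' : ∀ i j, i ≠ j → ∃ o, Apart C o (a i).toVisual (a j).toVisual := by
    intro i j hij
    rcases lt_or_gt_of_ne hij with hlt | hlt
    · exact h i j hlt
    · obtain ⟨o, ho⟩ := h j i hlt
      exact ⟨o, ho.symm⟩
  refine ⟨fun i j hij => ?_, fun i j hij α hα => ?_⟩
  · by_contra hne
    obtain ⟨o, ho⟩ := h' i j hne
    exact ho.ne (by rw [hij])
  · obtain ⟨o, ho⟩ := h' i j hij
    exact ho.isContracting_line hα

theorem IsTwoStable.exists_projGap {f : MorseBoundary X x₀ → MorseBoundary Y y₀}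
    (hf : IsTwoStable f) (C : ℝ) : ∃ C' : ℝ, 1 ≤ C' ∧ ∀ (o : X) (a b : MorseBoundary X x₀),
      Apart C o a.toVisual b.toVisual → ∀ α : GeodesicLine Y,
        α.Joins (f a).toVisual (f b).toVisual → ProjGap C' (range α) := by
  obtain ⟨D, hD⟩ := hf (2 * (86 * C).toNNReal)
  refine ⟨2 * D + 2, by linarith [D.coe_nonneg], fun o a b h α hα => ?_⟩
  have hmem : ![a, b] ∈ contractingTuples x₀ 2 (2 * (86 * C).toNNReal) := by
    refine mem_contractingTuples fun i j hij => ⟨o, ?_⟩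
    obtain rfl : i = 0 := by omega
    obtain rfl : j = 1 := by omega
    exact h
  exact α.projGap_of_isContracting ((hD _ hmem).2 0 1 (by simp) α hα)

/-- A 2-stable injection maps triangles with a center to triangles with a center. -/
theorem IsTwoStable.exists_center {f : MorseBoundary X x₀ → MorseBoundary Y y₀}
    (hf : IsTwoStable f) (hinj : Function.Injective f) (C : ℝ) :
    ∃ C' : ℝ, ∀ (o : X) (a b c : MorseBoundary X x₀), IsCenter C o a b c →
      ∃ o', IsCenter C' o' (f a) (f b) (f c) := by
  obtain ⟨C', hC', h'⟩ := hf.exists_projGap C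
  refine ⟨35 * C', fun o a b c h => ?_⟩
  have ne : ∀ a b : MorseBoundary X x₀, Apart C o a.toVisual b.toVisual → f a ≠ f b := by
    intro a b h e
    exact h.ne (by rw [hinj e])
  exact MorseBoundary.exists_center (ne _ _ h.ab) (ne _ _ h.bc) (ne _ _ h.ac) hC'
    (h' o a b h.ab) (h' o b c h.bc) (h' o a c h.ac)

/-- If two triples with two common points have a common center, then the cross-ratio of the four
points is bounded; hence so is that of their images, and the centers of the image triples are
close. -/
theorem exists_dist_center_le_of_common_pair {f : MorseBoundary X x₀ → MorseBoundary Y y₀}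
    (hqm : ∀ D, IsQuasiMobiusAt D f) (C C' : ℝ) :
    ∃ K : ℝ, ∀ (o : X) (a b c d : MorseBoundary X x₀) (y y' : Y),
      IsCenter C o a b c → IsCenter C o a b d →
      IsCenter C' y (f a) (f b) (f c) → IsCenter C' y' (f a) (f b) (f d) → dist y y' ≤ K := by
  obtain ⟨ψ, hψ, hqm⟩ := hqm (2 * (86 * (11 * C)).toNNReal)
  obtain ⟨M, hM⟩ := (isCompact_Icc (a := (0 : ℝ≥0)) (b := (280 * C).toNNReal)).bddAbove_image
    hψ.continuousOn
  refine ⟨M + 280 * C', fun o a b c d y y' h h' k k' => ?_⟩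
  have hC := h.one_le
  by_cases hcd : c = d
  · subst hcd
    linarith [k.dist_center_le k', M.coe_nonneg]
  -- The points `c` and `d` may be arbitrarily close as seen from `o`, but they diverge somewhere.
  obtain ⟨o', ho'⟩ := RayGap.exists_apart hC h.bc.right h'.bc.right
    fun e => hcd (Subtype.ext e)
  have hle : C ≤ 11 * C := by linarith
  have hmem : ![a, c, b, d] ∈ contractingTuples x₀ 4 (2 * (86 * (11 * C)).toNNReal) := by
    refine mem_contractingTuples fun i j hij => ?_
    fin_cases i <;> fin_cases j <;> first | exact absurd hij (by decide) | skip
    · exact ⟨o, h.ac.mono hle⟩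
    · exact ⟨o, h.ab.mono hle⟩
    · exact ⟨o, h'.ac.mono hle⟩
    · exact ⟨o, h.bc.symm.mono hle⟩
    · exact ⟨o', ho'⟩
    · exact ⟨o, h'.bc.mono hle⟩
  have h1 := hqm _ hmem
  have h2 : absCrossRatio a c b d ≤ 280 * C :=
    absCrossRatio_le (o := o) h.swap.rotate h'.swap.rotate
  have h3 : ψ ⟨absCrossRatio a c b d, absCrossRatio_nonneg _ _ _ _⟩ ≤ M := by
    refine hM (mem_image_of_mem ψ ⟨zero_le, ?_⟩)
    exact NNReal.coe_le_coe.1 (h2.trans (Real.le_coe_toNNReal _))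
  have h4 : absCrossRatio (f a) (f c) (f b) (f d) ≤ M := h1.trans (by exact_mod_cast h3)
  have := dist_center_le_absCrossRatio (a := f a) (b := f c) (c := f b) (d := f d)
    k.swap.rotate k'.swap.rotate
  linarith

/-- Of three points with center `o`, one diverges at `o` from both of the given points `p`,
`q`. -/
theorem Tripod.exists_third {C : ℝ} {o : X} {u v w p q : VisualBoundary X}
    (h : Tripod C o u v w) (hpq : Apart C o p q) :
    ∃ s, (s = u ∨ s = v ∨ s = w) ∧ Tripod (4 * C) o p q s := by
  have hpq' : Apart (4 * C) o p q := hpq.mono (by linarith [hpq.one_le])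
  have p1 := h.ab.exchange hpq.left
  have p2 := h.bc.exchange hpq.left
  have p3 := h.ac.exchange hpq.left
  have q1 := h.ab.exchange hpq.right
  have q2 := h.bc.exchange hpq.right
  have q3 := h.ac.exchange hpq.right
  have done : ∀ s, Apart (4 * C) o s p → Apart (4 * C) o s q → Tripod (4 * C) o p q s :=
    fun s hp hq => ⟨hpq', hq.symm, hp.symm⟩
  have : (Apart (4 * C) o u p ∧ Apart (4 * C) o u q) ∨ (Apart (4 * C) o v p ∧
      Apart (4 * C) o v q) ∨ (Apart (4 * C) o w p ∧ Apart (4 * C) o w q) := by tauto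
  rcases this with ⟨hp, hq⟩ | ⟨hp, hq⟩ | ⟨hp, hq⟩
  · exact ⟨u, Or.inl rfl, done u hp hq⟩
  · exact ⟨v, Or.inr (Or.inl rfl), done v hp hq⟩
  · exact ⟨w, Or.inr (Or.inr rfl), done w hp hq⟩

/-- Every further boundary point diverges at a center from two of the three vertices. -/
theorem Tripod.exists_pair {C : ℝ} {o : X} {a b c u : VisualBoundary X} (h : Tripod C o a b c)
    (hu : RayGap C o u) : Tripod (4 * C) o a b u ∨ Tripod (4 * C) o b c u ∨
      Tripod (4 * C) o c a u := by
  have hC : C ≤ 4 * C := by linarith [h.one_le]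
  have u1 := h.ab.exchange hu
  have u2 := h.bc.exchange hu
  have u3 := h.ac.exchange hu
  have : (Apart (4 * C) o a u ∧ Apart (4 * C) o b u) ∨ (Apart (4 * C) o b u ∧
      Apart (4 * C) o c u) ∨ (Apart (4 * C) o c u ∧ Apart (4 * C) o a u) := by tauto
  rcases this with ⟨hp, hq⟩ | ⟨hp, hq⟩ | ⟨hp, hq⟩
  · exact Or.inl ⟨h.ab.mono hC, hq, hp⟩
  · exact Or.inr (Or.inl ⟨h.bc.mono hC, hq, hp⟩)
  · exact Or.inr (Or.inr ⟨h.ac.symm.mono hC, hq, hp⟩)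

/-- The center of the image of a triple depends, up to a bounded error, only on the center of the
triple: exchange the points of one triple against those of the other, one at a time. -/
theorem exists_dist_center_le {f : MorseBoundary X x₀ → MorseBoundary Y y₀}
    (hf : IsTwoStable f) (hinj : Function.Injective f) (hqm : ∀ D, IsQuasiMobiusAt D f)
    (C r : ℝ) : ∃ K : ℝ, ∀ (o o' : X) (a b c u v w : MorseBoundary X x₀) (y y' : Y),
      dist o o' ≤ r → IsCenter C o a b c → IsCenter C o' u v w →
      IsCenter C y (f a) (f b) (f c) → IsCenter C y' (f u) (f v) (f w) → dist y y' ≤ K := by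
  set A := 3 * C + 8 * r with hA
  obtain ⟨B, hB⟩ := hf.exists_center hinj (16 * A)
  obtain ⟨K, hK⟩ := exists_dist_center_le_of_common_pair hqm (16 * A) (max B C)
  refine ⟨3 * K, fun o o' a b c u v w y y' hoo h h' k k' => ?_⟩
  have hr : 0 ≤ r := dist_nonneg.trans hoo
  have hC := h.one_le
  have hAC : C ≤ A := by linarith
  replace h : IsCenter A o a b c := h.mono hAC
  replace h' : IsCenter A o u v w := h'.move (by rwa [dist_comm])
  replace k := k.mono (le_max_right B C)
  replace k' := k'.mono (le_max_right B C)
  have cen : ∀ a b c, IsCenter (16 * A) o a b c →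
      ∃ z, IsCenter (max B C) z (f a) (f b) (f c) := by
    intro a b c h
    obtain ⟨z, hz⟩ := hB o a b c h
    exact ⟨z, hz.mono (le_max_left _ _)⟩
  -- The point `u` is exchanged against one of `a`, `b`, `c`.
  obtain ⟨p, q, z, h1, k1, hd1⟩ : ∃ (p q : MorseBoundary X x₀) (z : Y),
      IsCenter (4 * A) o p q u ∧ IsCenter (max B C) z (f p) (f q) (f u) ∧ dist y z ≤ K := by
    have step : ∀ p q s, IsCenter A o p q s → IsCenter (max B C) y (f p) (f q) (f s) →
        IsCenter (4 * A) o p q u → ∃ (p q : MorseBoundary X x₀) (z : Y),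
        IsCenter (4 * A) o p q u ∧ IsCenter (max B C) z (f p) (f q) (f u) ∧ dist y z ≤ K := by
      intro p q s h k h1
      obtain ⟨z, hz⟩ := cen p q u (h1.mono (by linarith))
      exact ⟨p, q, z, h1, hz, hK o p q s u y z (h.mono (by linarith)) (h1.mono (by linarith)) k hz⟩
    rcases h.exists_pair h'.ab.left with e | e | e
    · exact step a b c h k e
    · exact step b c a h.rotate k.rotate e
    · exact step c a b h.rotate.rotate k.rotate.rotate e
  -- The point `v` is exchanged against one of `p`, `q`.
  obtain ⟨s, z', h2, k2, hd2⟩ : ∃ (s : MorseBoundary X x₀) (z' : Y),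
      IsCenter (16 * A) o u v s ∧ IsCenter (max B C) z' (f u) (f v) (f s) ∧ dist z z' ≤ K := by
    have step : ∀ p q, IsCenter (4 * A) o p q u → IsCenter (max B C) z (f p) (f q) (f u) →
        Apart (4 * (4 * A)) o q.toVisual v.toVisual → ∃ (s : MorseBoundary X x₀) (z' : Y),
        IsCenter (16 * A) o u v s ∧ IsCenter (max B C) z' (f u) (f v) (f s) ∧
          dist z z' ≤ K := by
      intro p q h k e
      have h2 : IsCenter (16 * A) o u v q := by
        refine ⟨h'.ab.mono (by linarith), ?_, h.bc.symm.mono (by linarith)⟩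
        convert e.symm using 1; ring
      obtain ⟨z', hz'⟩ := cen u v q h2
      refine ⟨q, z', h2, hz', hK o q u p v z z' ?_ h2.rotate.rotate k.rotate hz'.rotate.rotate⟩
      exact h.rotate.mono (by linarith)
    rcases h1.ab.exchange (h'.ab.right.mono (by linarith)) with e | e
    · exact step q p h1.swap k1.swap e
    · exact step p q h1 k1 e
  have hd3 := hK o u v s w z' y' h2 (h'.mono (by linarith)) k2 k'
  have := dist_triangle4 y z z' y'
  linarith

end Maps

/-! ### Quasi-isometries from coarse correspondences -/

section QuasiIsometry

variable {X Y : Type*} [MetricSpace X] [CAT0Space X] [MetricSpace Y]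

theorem dist_le_mul_add_of_dist_le_one {h : X → Y} {K : ℝ}
    (hK : ∀ x x', dist x x' ≤ 1 → dist (h x) (h x') ≤ K) (x x' : X) :
    dist (h x) (h x') ≤ K * dist x x' + K := by
  have hK0 : 0 ≤ K := dist_nonneg.trans (hK x x (by simp))
  have step : ∀ n : ℕ, ∀ x x', dist x x' ≤ n → dist (h x) (h x') ≤ n * K := by
    intro n
    induction n with
    | zero =>
      intro x x' hx
      rw [Nat.cast_zero] at hx
      rw [dist_le_zero.1 hx]; simp
    | succ n ih =>
      intro x x' hx
      push_cast at hx ⊢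
      rcases le_total (dist x x') n with hn | hn
      · linarith [ih x x' hn]
      · obtain ⟨γ, h0, h1, hγ⟩ := CAT0Space.geodesic x x'
        have m0 : (0 : ℝ) ∈ Icc 0 (dist x x') := ⟨le_rfl, dist_nonneg⟩
        have mn : (n : ℝ) ∈ Icc 0 (dist x x') := ⟨n.cast_nonneg, hn⟩
        have m1 : dist x x' ∈ Icc 0 (dist x x') := ⟨dist_nonneg, le_rfl⟩
        have e1 := hγ _ m0 _ mn
        have e2 := hγ _ mn _ m1
        rw [h0, zero_sub, abs_neg, abs_of_nonneg n.cast_nonneg] at e1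
        rw [h1, abs_of_nonpos (by linarith)] at e2
        have := ih x (γ n) e1.le
        have := hK (γ n) x' (by linarith)
        linarith [dist_triangle (h x) (h (γ n)) (h x')]
  have h1 := step ⌈dist x x'⌉₊ x x' (Nat.le_ceil _)
  have h2 := Nat.ceil_lt_add_one (dist_nonneg (x := x) (y := x'))
  nlinarith

variable [CAT0Space Y]

/-- A relation between two geodesic spaces that is total on both sides and coarsely well defined in
both directions is the graph of a quasi-isometry, up to bounded errors. -/
theorem isQuasiIsometry_of_relation {R : X → Y → Prop} (hY : ∀ y, ∃ x, R x y)
    (h₁ : ∀ r : ℝ, ∃ K : ℝ, ∀ x x' y y', R x y → R x' y' → dist x x' ≤ r → dist y y' ≤ K)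
    (h₂ : ∀ r : ℝ, ∃ K : ℝ, ∀ x x' y y', R x y → R x' y' → dist y y' ≤ r → dist x x' ≤ K)
    {h : X → Y} (hh : ∀ x, R x (h x)) : IsQuasiIsometry h := by
  choose k hk using hY
  obtain ⟨K₁, hK₁⟩ := h₁ 1
  obtain ⟨K₂, hK₂⟩ := h₂ 1
  obtain ⟨K₃, hK₃⟩ := h₂ 0
  obtain ⟨K₄, hK₄⟩ := h₁ 0
  have lip := dist_le_mul_add_of_dist_le_one (h := h) (K := max K₁ 0) fun x x' hx =>
    (hK₁ _ _ _ _ (hh x) (hh x') hx).trans (le_max_left _ _)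
  have lip' := dist_le_mul_add_of_dist_le_one (h := k) (K := max K₂ 0) fun y y' hy =>
    (hK₂ _ _ _ _ (hk y) (hk y') hy).trans (le_max_left _ _)
  set A := max K₁ 0
  set B := max K₂ 0
  have hA : 0 ≤ A := le_max_right _ _
  have hB : 0 ≤ B := le_max_right _ _
  set L := A + B + 1 with hL
  have hL1 : 1 ≤ L := by linarith
  refine ⟨L, A + B + 2 * |K₃| + |K₄|, hL1, by positivity, fun x x' => ⟨?_, ?_⟩, fun y => ?_⟩
  · have e1 := hK₃ _ _ _ _ (hk (h x)) (hh x) (by simp)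
    have e2 := hK₃ _ _ _ _ (hk (h x')) (hh x') (by simp)
    have e3 := lip' (h x) (h x')
    have t := dist_triangle4 x (k (h x)) (k (h x')) x'
    rw [dist_comm x (k (h x))] at t
    have hd := dist_nonneg (x := h x) (y := h x')
    have hK3 := le_abs_self K₃
    have e4 : dist x x' ≤ L * (dist (h x) (h x') + (A + B + 2 * |K₃| + |K₄|)) := by
      nlinarith [abs_nonneg K₃, abs_nonneg K₄]
    have hL0 : 0 < L := by linarith
    have := (inv_mul_le_iff₀ hL0).2 e4
    linarith
  · have := lip x x'
    nlinarith [abs_nonneg K₃, abs_nonneg K₄, dist_nonneg (x := x) (y := x')]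
  · refine ⟨k y, ?_⟩
    have := hK₄ _ _ _ _ (hh (k y)) (hk y) (by simp)
    linarith [abs_nonneg K₃, le_abs_self K₄]

end QuasiIsometry

/-! ### Cocompact actions -/

section Action

variable {X G : Type*} [MetricSpace X] [Group G] [MulAction G X] [IsIsometricSMul G X]

theorem ProjGap.smul {C : ℝ} {A : Set X} (h : ProjGap C A) (g : G) :
    ProjGap C ((fun x => g • x) '' A) := by
  have key : ∀ x p, IsNearestPoint ((fun x => g • x) '' A) x p →
      IsNearestPoint A (g⁻¹ • x) (g⁻¹ • p) := by
    intro x p hp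
    obtain ⟨p, hpA, rfl⟩ := hp.1
    refine isNearestPoint_of_forall (by simpa using hpA) fun q hq => ?_
    have := hp.dist_le (mem_image_of_mem _ hq)
    rw [← dist_smul g (g⁻¹ • x) q, smul_inv_smul, dist_smul]
    exact this
  intro x y p q hp hq hlt
  have := h _ _ _ _ (key x p hp) (key y q hq) (by rwa [dist_smul])
  simpa only [dist_smul] using this

variable [CAT0Space X] [ProperSpace X]

/-- The action on the visual boundary. -/
theorem exists_ray_smul (x₀ : X) (g : G) (ξ : VisualBoundary X) :
    ∃ ξ' : VisualBoundary X, ∀ o t, 0 ≤ t → ray (g • o) ξ' t = g • ray o ξ t := by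
  have geod : ∀ o, GeodOn (fun t => g • ray o ξ t) (Ici 0) := fun o s hs t ht => by
    rw [dist_smul, ray_geodOn o ξ s hs t ht]
  refine ⟨(geod x₀).toRay.endpoint, fun o t ht => ?_⟩
  have h1 := (geod x₀).toRay.isRayTo
  have h2 : IsRayTo (fun t => g • ray o ξ t) (geod x₀).toRay.endpoint := by
    refine h1.of_bounded (geod o) (N := dist o x₀) fun t ht => ?_
    rw [GeodesicRay.real, GeodOn.toRay_apply, Real.coe_toNNReal _ ht, dist_smul]
    exact dist_ray_ray _ _ _ ht
  have := h2.eq_ray ht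
  rw [ray_zero] at this
  exact this.symm

theorem exists_isCenter_smul {x₀ : X} (g : G) {C : ℝ} {o : X} {a b c : MorseBoundary X x₀}
    (h : IsCenter C o a b c) : ∃ a' b' c' : MorseBoundary X x₀, IsCenter C (g • o) a' b' c' := by
  obtain ⟨a', ha⟩ := exists_ray_smul x₀ g a.toVisual
  obtain ⟨b', hb⟩ := exists_ray_smul x₀ g b.toVisual
  obtain ⟨c', hc⟩ := exists_ray_smul x₀ g c.toVisual
  have gap : ∀ ξ ξ' : VisualBoundary X, (∀ o t, 0 ≤ t → ray (g • o) ξ' t = g • ray o ξ t) →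
      RayGap C o ξ → RayGap C (g • o) ξ' := by
    intro ξ ξ' hξ hgap
    have := ProjGap.smul hgap g
    rw [image_image] at this
    have e : ray (g • o) ξ' '' Ici 0 = (fun t => g • ray o ξ t) '' Ici 0 :=
      image_congr fun t ht => hξ o t ht
    rwa [RayGap, e]
  have apart : ∀ ξ ξ' η η' : VisualBoundary X,
      (∀ o t, 0 ≤ t → ray (g • o) ξ' t = g • ray o ξ t) →
      (∀ o t, 0 ≤ t → ray (g • o) η' t = g • ray o η t) →
      Apart C o ξ η → Apart C (g • o) ξ' η' := by
    intro ξ ξ' η η' hξ hη h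
    refine ⟨h.one_le, gap _ _ hξ h.left, gap _ _ hη h.right, fun s t hs ht => ?_⟩
    rw [hξ o s hs, hη o t ht, dist_smul]
    exact h.div s t hs ht
  have morse : ∀ ξ' : VisualBoundary X, RayGap C (g • o) ξ' → ∃ D : ℝ≥0, ξ' ∈ stratum x₀ D :=
    fun ξ' h => (exists_stratum_iff x₀ ξ').2 ⟨_, h.move le_rfl⟩
  exact ⟨⟨a', morse a' (gap _ _ ha h.ab.left)⟩, ⟨b', morse b' (gap _ _ hb h.ab.right)⟩,
    ⟨c', morse c' (gap _ _ hc h.bc.right)⟩, apart _ _ _ _ ha hb h.ab, apart _ _ _ _ hb hc h.bc,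
    apart _ _ _ _ ha hc h.ac⟩

/-- Under a cocompact action, every point is a center of an ideal triangle, with a uniform
constant. -/
theorem IsCocompactAction.exists_isCenter (hG : IsCocompactAction G X) {x₀ : X}
    (h3 : ∃ a b c : MorseBoundary X x₀, a ≠ b ∧ b ≠ c ∧ a ≠ c) :
    ∃ C : ℝ, ∀ x : X, ∃ a b c : MorseBoundary X x₀, IsCenter C x a b c := by
  obtain ⟨a, b, c, hab, hbc, hac⟩ := h3
  obtain ⟨C, hC⟩ := MorseBoundary.exists_tripod hab hbc hac x₀
  obtain ⟨K, hK, hcov⟩ := hG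
  obtain ⟨r, hr⟩ := hK.isBounded.subset_closedBall x₀
  refine ⟨3 * C + 8 * r, fun x => ?_⟩
  obtain ⟨g, k, hk, rfl⟩ := hcov x
  obtain ⟨a', b', c', h⟩ := exists_isCenter_smul g hC
  refine ⟨a', b', c', h.move ?_⟩
  rw [dist_smul, dist_comm]
  exact hr hk

end Action

/-! ### The boundary map of the quasi-isometry -/

section BoundaryMap

/-- A quasi-isometry that maps a ray into a neighborhood of a ray maps it to finite Hausdorff
distance from it: the nearby parameters on the second ray increase to infinity with bounded
steps. -/
theorem IsQuasiIsometry.hausdorffEDist_ne_top {X Y : Type*} [MetricSpace X] [MetricSpace Y]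
    {h : X → Y} (hh : IsQuasiIsometry h)
    (α : GeodesicRay X) (β : GeodesicRay Y) {K : ℝ}
    (hK : ∀ t : ℝ, 0 ≤ t → ∃ w, 0 ≤ w ∧ dist (h (α.real t)) (β.real w) ≤ K) :
    hausdorffEDist (h '' range α) (range β) ≠ ⊤ := by
  obtain ⟨L, ε, hL, hε, hqi, -⟩ := hh
  have hK0 : 0 ≤ K := by
    obtain ⟨w, -, hw⟩ := hK 0 le_rfl
    exact dist_nonneg.trans hw
  rw [hausdorffEDist_ne_top_iff, ← α.image_real, ← β.image_real]
  choose w hw0 hw using fun n : ℕ => hK n n.cast_nonneg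
  have step : ∀ n, w (n + 1) ≤ w n + (L + ε + 2 * K) := by
    intro n
    have e1 := (hqi (α.real n) (α.real (n + 1 : ℕ))).2
    rw [α.geodOn n (mem_Ici.2 n.cast_nonneg) _ (mem_Ici.2 (n + 1).cast_nonneg)] at e1
    push_cast at e1
    rw [show (n : ℝ) - (n + 1) = -1 by ring, abs_neg, abs_one] at e1
    have e2 := β.geodOn (w n) (hw0 n) (w (n + 1)) (hw0 _)
    have e3 := hw n
    have e4 := hw (n + 1)
    push_cast at e4
    have t := dist_triangle4 (β.real (w n)) (h (α.real n)) (h (α.real (n + 1)))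
      (β.real (w (n + 1)))
    rw [dist_comm (β.real (w n)) (h _)] at t
    linarith [neg_abs_le (w n - w (n + 1))]
  have unb : ∀ s : ℝ, ∃ n, s < w n := by
    intro s
    obtain ⟨n, hn⟩ := exists_nat_gt (L * (s + w 0 + ε + 2 * K))
    refine ⟨n, ?_⟩
    by_contra! hle
    have e1 := (hqi (α.real 0) (α.real n)).1
    rw [α.geodOn 0 (mem_Ici.2 le_rfl) n (mem_Ici.2 n.cast_nonneg), zero_sub, abs_neg,
      abs_of_nonneg n.cast_nonneg] at e1
    have e2 := β.geodOn (w 0) (hw0 0) (w n) (hw0 _)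
    have e3 := hw 0
    rw [Nat.cast_zero] at e3
    have e4 := hw n
    have t := dist_triangle4 (h (α.real 0)) (β.real (w 0)) (β.real (w n)) (h (α.real n))
    rw [dist_comm (β.real (w n)) (h _)] at t
    have e5 : |w 0 - w n| ≤ s + w 0 := by
      rw [abs_le]; constructor <;> linarith [hw0 0, hw0 n]
    have hL0 : 0 < L := by linarith
    have e6 : L⁻¹ * n ≤ s + w 0 + ε + 2 * K := by linarith
    rw [inv_mul_le_iff₀ hL0] at e6
    linarith
  refine ⟨L + ε + 3 * K + w 0, ?_, ?_⟩
  · rintro _ ⟨_, ⟨t, ht, rfl⟩, rfl⟩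
    obtain ⟨s, hs, hst⟩ := hK t ht
    exact ⟨_, ⟨s, hs, rfl⟩, hst.trans (by linarith [hw0 0])⟩
  · rintro _ ⟨s, hs, rfl⟩
    rw [mem_Ici] at hs
    obtain ⟨n, hn⟩ : ∃ n, |w n - s| ≤ L + ε + 2 * K + w 0 := by
      classical
      set n := Nat.find (unb s) with hn
      have h1 : s < w n := Nat.find_spec (unb s)
      rcases Nat.eq_zero_or_pos n with h0 | hpos
      · refine ⟨n, ?_⟩
        rw [h0] at h1 ⊢
        rw [abs_le]; constructor <;> linarith
      · have h2 : w (n - 1) ≤ s := not_lt.1 (Nat.find_min (unb s) (by omega))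
        have h3 := step (n - 1)
        rw [Nat.sub_add_cancel hpos] at h3
        refine ⟨n, ?_⟩
        rw [abs_le]; constructor <;> linarith [hw0 0]
    refine ⟨_, ⟨_, ⟨n, mem_Ici.2 n.cast_nonneg, rfl⟩, rfl⟩, ?_⟩
    have e1 := hw n
    have t := dist_triangle (h (α.real n)) (β.real (w n)) (β.real s)
    rw [β.geodOn _ (hw0 n) _ hs] at t
    linarith

variable {X : Type*} [MetricSpace X] [CAT0Space X] [ProperSpace X]

/-- Let `y'` be a center of the triangle `a`, `b`, `s`. If `a` and `s` diverge at a point `y` that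
is close to the line from `a` to `b`, then `y'` is not far behind `y` on that line: otherwise the
line from `a` to `s` would have left it before reaching `y`. -/
theorem Tripod.param_le {C : ℝ} {y y' : X} {a b s : VisualBoundary X} (h : Tripod C y' a b s)
    (hy : Apart C y a s) {l : GeodesicLine X} (hl : l.Joins a b) {t₀ t : ℝ}
    (ht₀ : dist y (l t₀) ≤ 5 * C) (ht : dist y' (l t) ≤ 5 * C) : t₀ - t ≤ 22 * C := by
  have hC := h.one_le
  by_contra! hlt
  obtain ⟨m, hm⟩ := hy.exists_joins
  obtain ⟨u₀, hu₀⟩ := hy.exists_dist_line_le hm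
  obtain ⟨u, hu⟩ := h.ac.exists_dist_line_le hm
  rcases le_total u₀ u with hle | hle
  · -- Both lines run together from `y'` back to `a`.
    have hw : 0 ≤ u - u₀ := by linarith
    have e1 := dist_ray_ray (m u) y' a hw
    have e2 := dist_ray_ray y' (l t) a hw
    rw [← hm.apply_sub u hw, sub_sub_cancel, dist_comm (m u)] at e1
    rw [← hl.apply_sub t hw] at e2
    have t1 := dist_triangle4 (m u₀) (ray y' a (u - u₀)) (l (t - (u - u₀))) (l t₀)
    have t2 := dist_triangle4 (l (t - (u - u₀))) (ray y' a (u - u₀)) (m u₀) y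
    have t3 := dist_triangle (l (t - (u - u₀))) y (l t₀)
    rw [l.dist_eq] at t3
    rw [dist_comm (l (t - (u - u₀))) (ray y' a _), dist_comm (ray y' a _) (m u₀),
      dist_comm (m u₀) y] at t2
    linarith [neg_abs_le (t - (u - u₀) - t₀)]
  · -- Both lines pass from `y'` to `y`, the one towards `b` and the other towards `s`.
    have hw : 0 ≤ u₀ - u := by linarith
    have hT : 0 ≤ t₀ - t := by linarith
    have e1 := dist_ray_ray (m u) y' s hw
    have e2 := dist_ray_ray (l t) y' b hT
    rw [← hm.apply_add u hw, add_sub_cancel, dist_comm (m u)] at e1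
    rw [← hl.apply_add t hT, add_sub_cancel, dist_comm (l t)] at e2
    have e3 := h.bc.div (t₀ - t) (u₀ - u) hT hw
    have t1 := dist_triangle4 (ray y' b (t₀ - t)) (l t₀) (m u₀) (ray y' s (u₀ - u))
    have t2 := dist_triangle_left (l t₀) (m u₀) y
    rw [dist_comm _ (l t₀)] at t1
    linarith

/-- If `q` and `s` diverge at a point `x` of a line to `p` coming from `q`, then they
also diverge at the points of the line before `x`. -/
theorem Apart.move_back {C K : ℝ} {o x : X} {q p s : VisualBoundary X} (h : Apart C x q s)
    {l : GeodesicLine X} (hl : l.Joins q p) {t₀ t : ℝ} (ht : 0 ≤ t)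
    (h₀ : dist o (l t₀) ≤ K) (hx : dist x (l (t₀ + t)) ≤ K) :
    Apart (298 * C + 16 * K) o q s := by
  have hC := h.one_le
  obtain ⟨m, hm⟩ := h.exists_joins
  obtain ⟨u, hu⟩ := h.exists_dist_line_le hm
  have e1 := dist_ray_ray (m u) x q ht
  have e2 := dist_ray_ray x (l (t₀ + t)) q ht
  rw [← hm.apply_sub u ht, dist_comm (m u)] at e1
  rw [← hl.apply_sub (t₀ + t) ht, add_sub_cancel_right] at e2
  have t1 := dist_triangle4 (m (u - t)) (ray x q t) (l t₀) o
  rw [dist_comm (l t₀) o] at t1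
  have hd : dist (m (u - t)) o ≤ 5 * C + 2 * K := by linarith
  have := hm.apart (C := 86 * C) (by linarith) (h.projGap_line hm) hd
  convert this using 1; ring

end BoundaryMap

section Main

variable {X Y : Type*} [MetricSpace X] [CAT0Space X] [ProperSpace X]
  [MetricSpace Y] [CAT0Space Y] [ProperSpace Y] {x₀ : X} {y₀ : Y}

/-- A quasi-isometry that coarsely maps the centers of ideal triangles to the centers of their
images under `f` induces `f`. -/
theorem inducesOnMorseBoundary_of_isCenter {f : MorseBoundary X x₀ → MorseBoundary Y y₀}
    (hf : IsTwoStable f) (hinj : Function.Injective f) (hqm : ∀ D, IsQuasiMobiusAt D f)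
    (h3 : ∃ a b c : MorseBoundary X x₀, a ≠ b ∧ b ≠ c ∧ a ≠ c) {h : X → Y}
    (hqi : IsQuasiIsometry h) {C : ℝ}
    (hh : ∀ x, ∃ a b c, IsCenter C x a b c ∧ IsCenter C (h x) (f a) (f b) (f c)) :
    InducesOnMorseBoundary h f := by
  intro p α β hα hβ
  obtain ⟨q, r, hqr, hrp, hqp⟩ : ∃ q r : MorseBoundary X x₀, q ≠ r ∧ r ≠ p ∧ q ≠ p := by
    obtain ⟨a, b, c, hab, hbc, hac⟩ := h3
    by_cases ha : a = p
    · subst ha; exact ⟨b, c, hbc, hac.symm, hab.symm⟩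
    · by_cases hb : b = p
      · subst hb; exact ⟨a, c, hac, hbc.symm, hab⟩
      · exact ⟨a, b, hab, hb, ha⟩
  set o := α.real 0 with ho
  have hαray : ∀ t, 0 ≤ t → α.real t = ray o p.toVisual t := fun t ht => by
    rw [← hα]; exact α.isRayTo.eq_ray ht
  have hβray : ∀ t, 0 ≤ t → β.real t = ray (β.real 0) (f p).toVisual t := fun t ht => by
    rw [← hβ]; exact β.isRayTo.eq_ray ht
  obtain ⟨C₀, hC₀⟩ := MorseBoundary.exists_tripod hqr hrp hqp o
  obtain ⟨E₀, hE₀⟩ := MorseBoundary.exists_tripod (hinj.ne hqr) (hinj.ne hrp) (hinj.ne hqp) (h o)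
  have hC1 := hC₀.one_le
  have hE1 := hE₀.one_le
  obtain ⟨l, hl⟩ := hC₀.ac.exists_joins
  obtain ⟨t₀, ht₀⟩ := hC₀.ac.exists_dist_line_le hl
  obtain ⟨l', hl'⟩ := hE₀.ac.exists_joins
  obtain ⟨t₀', ht₀'⟩ := hE₀.ac.exists_dist_line_le hl'
  have hx : ∀ t, 0 ≤ t → dist (α.real t) (l (t₀ + t)) ≤ 5 * C₀ := fun t ht => by
    rw [hαray t ht, hl.apply_add t₀ ht]
    exact (dist_ray_ray _ _ _ ht).trans ht₀
  -- Each point of the ray is the center of a triangle with vertices `q` and `p`.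
  obtain ⟨A, hA⟩ : ∃ A, ∀ t, 0 ≤ t → ∃ s, IsCenter A (α.real t) q p s := by
    refine ⟨4 * max (3 * (86 * C₀) + 8 * (5 * C₀)) C, fun t ht => ?_⟩
    obtain ⟨u, v, w, huvw, -⟩ := hh (α.real t)
    have h1 : Apart (3 * (86 * C₀) + 8 * (5 * C₀)) (α.real t) q.toVisual p.toVisual :=
      hl.apart (t := t₀ + t) (by linarith) (hC₀.ac.projGap_line hl)
        (by rw [dist_comm]; exact hx t ht)
    obtain ⟨s, hs, hT⟩ := Tripod.exists_third (huvw.mono (le_max_right _ _))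
      (h1.mono (le_max_left _ C))
    rcases hs with rfl | rfl | rfl
    · exact ⟨u, hT⟩
    · exact ⟨v, hT⟩
    · exact ⟨w, hT⟩
  have hA1 : 1 ≤ A := by
    obtain ⟨s, hs⟩ := hA 0 le_rfl
    exact hs.one_le
  obtain ⟨B, hB⟩ := hf.exists_center hinj A
  obtain ⟨K, hK⟩ := exists_dist_center_le hf hinj hqm (max (max A B) C) 0
  have near : ∀ t, 0 ≤ t → ∀ s, IsCenter A (α.real t) q p s →
      ∃ y, IsCenter B y (f q) (f p) (f s) ∧ dist y (h (α.real t)) ≤ K := by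
    intro t ht s hs
    obtain ⟨y, hy⟩ := hB _ _ _ _ hs
    obtain ⟨u, v, w, huvw, huvw'⟩ := hh (α.real t)
    exact ⟨y, hy, hK _ _ _ _ _ _ _ _ _ _ (dist_self _).le
      (hs.mono (le_max_of_le_left (le_max_left _ _))) (huvw.mono (le_max_right _ _))
      (hy.mono (le_max_of_le_left (le_max_right _ _))) (huvw'.mono (le_max_right _ _))⟩
  set A' := 298 * A + 16 * (5 * C₀) with hA'
  obtain ⟨B', hB'⟩ := hf.exists_center hinj (4 * A')
  obtain ⟨K', hK'⟩ := exists_dist_center_le hf hinj hqm (max (max (4 * A') B') E₀) 0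
  obtain ⟨L, ε, hL, hε, hLε, hsurj⟩ := id hqi
  set G := max (max (3 * B' + 8 * K') B) E₀ with hG
  set P := max (22 * G) (5 * E₀ + 5 * B + K + (L * (280 * (4 * A')) + ε)) with hP
  -- The image of the ray stays close to the half of `l'` that goes to `f p`.
  have half : ∀ t, 0 ≤ t → ∃ u, t₀' - P ≤ u ∧ dist (h (α.real t)) (l' u) ≤ K + 5 * B := by
    intro t ht
    obtain ⟨s, hs⟩ := hA t ht
    obtain ⟨y, hy, hyd⟩ := near t ht s hs
    obtain ⟨u, hu⟩ := hy.ab.exists_dist_line_le hl'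
    refine ⟨u, ?_, by linarith [dist_triangle_left (h (α.real t)) (l' u) y]⟩
    have hqs : Apart A' o q.toVisual s.toVisual :=
      hs.ac.move_back hl ht ht₀ (hx t ht)
    have hCA : C₀ ≤ A' := by linarith
    rcases (hC₀.bc.mono hCA).exchange hqs.right with hrs | hps
    · -- `s` diverges from `q` and `r` at `o`, hence `f s` from `f q` at `h o`.
      have h1 : IsCenter (4 * A') o q r s :=
        ⟨hC₀.ab.mono (by linarith), hrs, hqs.mono (by linarith)⟩
      obtain ⟨z, hz⟩ := hB' _ _ _ _ h1
      have h2 : dist z (h o) ≤ K' := hK' o o q r s q r p z (h o) (dist_self _).le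
        (h1.mono (le_max_of_le_left (le_max_left _ _)))
        (hC₀.mono (le_max_of_le_left (le_max_of_le_left (by linarith))))
        (hz.mono (le_max_of_le_left (le_max_right _ _))) (hE₀.mono (le_max_right _ _))
      have h3 : Apart G (h o) (f q).toVisual (f s).toVisual :=
        (hz.ac.move h2).mono (le_max_of_le_left (le_max_left _ _))
      have hBG : B ≤ G := le_max_of_le_left (le_max_right _ _)
      have hEG : E₀ ≤ G := le_max_right _ _
      have := (hy.mono hBG).param_le h3 hl' (ht₀'.trans (by linarith)) (hu.trans (by linarith))
      linarith [le_max_left (22 * G) (5 * E₀ + 5 * B + K + (L * (280 * (4 * A')) + ε))]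
    · -- Otherwise both `o` and `α t` are centers of the triangle `q`, `p`, `s`.
      have h1 : IsCenter (4 * A') o q p s :=
        ⟨hC₀.ac.mono (by linarith), hps, hqs.mono (by linarith)⟩
      have h2 := h1.dist_center_le (hs.mono (by linarith))
      have h3 := (hLε o (α.real t)).2
      have h4 : L * dist o (α.real t) ≤ L * (280 * (4 * A')) := by gcongr
      have h5 := dist_triangle4 (l' t₀') (h o) (h (α.real t)) y
      have h6 := dist_triangle (l' t₀') y (l' u)
      rw [l'.dist_eq] at h6
      rw [dist_comm _ (h o), dist_comm (h (α.real t)) y] at h5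
      linarith [le_max_right (22 * G) (5 * E₀ + 5 * B + K + (L * (280 * (4 * A')) + ε)),
        le_abs_self (t₀' - u)]
  refine hqi.hausdorffEDist_ne_top α β
    (K := K + 5 * B + max P 0 + dist (l' t₀') (β.real 0)) fun t ht => ?_
  obtain ⟨u, hu, hd⟩ := half t ht
  refine ⟨max (u - t₀') 0, le_max_right _ _, ?_⟩
  have hw : 0 ≤ max (u - t₀') 0 := le_max_right _ _
  have e1 := dist_ray_ray (l' t₀') (β.real 0) (f p).toVisual hw
  rw [← hl'.apply_add t₀' hw, ← hβray _ hw] at e1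
  have e2 : dist (l' u) (l' (t₀' + max (u - t₀') 0)) ≤ max P 0 := by
    rw [l'.dist_eq, abs_le]
    constructor <;> grind
  linarith [dist_triangle4 (h (α.real t)) (l' u) (l' (t₀' + max (u - t₀') 0))
    (β.real (max (u - t₀') 0))]

end Main

end MorseBdry

theorem theorem4p3 {X Y G H : Type*}
    [MetricSpace X] [ProperSpace X] [MorseBdry.CAT0Space X]
    [MetricSpace Y] [ProperSpace Y] [MorseBdry.CAT0Space Y]
    [Group G] [MulAction G X] [IsIsometricSMul G X] [ProperlyDiscontinuousSMul G X]
    [Group H] [MulAction H Y] [IsIsometricSMul H Y] [ProperlyDiscontinuousSMul H Y]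
    (hG : MorseBdry.IsCocompactAction G X) (hH : MorseBdry.IsCocompactAction H Y)
    (x₀ : X) (y₀ : Y)
    (h3 : ∃ a b c : MorseBdry.MorseBoundary X x₀, a ≠ b ∧ b ≠ c ∧ a ≠ c)
    (f : MorseBdry.MorseBoundary X x₀ ≃ₜ MorseBdry.MorseBoundary Y y₀)
    (hf : MorseBdry.IsTwoStable f) (hf' : MorseBdry.IsTwoStable f.symm)
    (hqm : MorseBdry.IsQuasiMobius f) (hqm' : MorseBdry.IsQuasiMobius f.symm) :
    ∃ h : X → Y, MorseBdry.IsQuasiIsometry h ∧ MorseBdry.InducesOnMorseBoundary h f := by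
  have h3' : ∃ a b c : MorseBdry.MorseBoundary Y y₀, a ≠ b ∧ b ≠ c ∧ a ≠ c := by
    obtain ⟨a, b, c, hab, hbc, hac⟩ := h3
    exact ⟨f a, f b, f c, f.injective.ne hab, f.injective.ne hbc, f.injective.ne hac⟩
  obtain ⟨C₁, h₁⟩ := hG.exists_isCenter h3
  obtain ⟨C₂, h₂⟩ := hH.exists_isCenter h3'
  obtain ⟨C₃, h₃⟩ := hf.exists_center f.injective C₁
  obtain ⟨C₄, h₄⟩ := hf'.exists_center f.symm.injective C₂
  set C := max (max C₁ C₂) (max C₃ C₄)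
  have hC₁ : C₁ ≤ C := le_max_of_le_left (le_max_left _ _)
  have hC₂ : C₂ ≤ C := le_max_of_le_left (le_max_right _ _)
  have hC₃ : C₃ ≤ C := le_max_of_le_right (le_max_left _ _)
  have hC₄ : C₄ ≤ C := le_max_of_le_right (le_max_right _ _)
  -- The quasi-isometry maps a center of a triangle to a center of the image triangle.
  let R : X → Y → Prop := fun x y =>
    ∃ a b c, MorseBdry.IsCenter C x a b c ∧ MorseBdry.IsCenter C y (f a) (f b) (f c)
  have hX : ∀ x, ∃ y, R x y := by
    intro x
    obtain ⟨a, b, c, h⟩ := h₁ x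
    obtain ⟨y, hy⟩ := h₃ x a b c h
    exact ⟨y, a, b, c, h.mono hC₁, hy.mono hC₃⟩
  have hY : ∀ y, ∃ x, R x y := by
    intro y
    obtain ⟨a, b, c, h⟩ := h₂ y
    obtain ⟨x, hx⟩ := h₄ y a b c h
    refine ⟨x, f.symm a, f.symm b, f.symm c, hx.mono hC₄, ?_⟩
    simpa using h.mono hC₂
  choose h hh using hX
  have hqi : MorseBdry.IsQuasiIsometry h := by
    refine MorseBdry.isQuasiIsometry_of_relation (R := R) hY (fun r => ?_) (fun r => ?_) hh
    · obtain ⟨K, hK⟩ := MorseBdry.exists_dist_center_le hf f.injective (fun D => (hqm D).1) C r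
      refine ⟨K, ?_⟩
      rintro x x' y y' ⟨a, b, c, k, k'⟩ ⟨u, v, w, m, m'⟩ hd
      exact hK x x' a b c u v w y y' hd k m k' m'
    · obtain ⟨K, hK⟩ := MorseBdry.exists_dist_center_le hf' f.symm.injective
        (fun D => (hqm D).2) C r
      refine ⟨K, ?_⟩
      rintro x x' y y' ⟨a, b, c, k, k'⟩ ⟨u, v, w, m, m'⟩ hd
      exact hK y y' (f a) (f b) (f c) (f u) (f v) (f w) x x' hd k' m' (by simpa using k)
        (by simpa using m)
  exact ⟨h, hqi, MorseBdry.inducesOnMorseBoundary_of_isCenter hf f.injective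
    (fun D => (hqm D).1) h3 hqi hh⟩
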